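/- Let $K$ be a field of characteristic zero, let $D\ge 1$ be an integer, and let $J(D)$ be the free (non-unital) Jordan algebra on $D$ generators over $K$, i.e. the free commutative $K$-algebra on $D$ generators subject to the Jordan identity $x^2(yx)=(x^2y)x$. For a Jordan algebra $J$ over $K$ put $\partial_{a,b}(z)=a(zb)-(az)b$ and $\mathcal{B}J=\Lambda^2J/R(J)$, where $R(J)$ is the linear span of all $a\wedge a^2$, and write $\{\omega\}$ for the class of $\omega\in\Lambda^2J$ and $\partial_\omega=\sum_i\partial_{a_i,b_i}$ for $\omega=\sum_i a_i\wedge b_i$. The Tits–Allison–Gao Lie algebra of $J$ is $\mathfrak{sl}_2J=\mathcal{B}J\oplus(\mathfrak{sl}_2\otimes J)$ with $$[x(a),y(b)]=[x,y](ab)+\kappa(x,y)\{a\wedge b\},\quad [\{\omega\},x(a)]=x(\partial_\omega a),\quad [\{\omega\},\{a\wedge b\}]=\{\partial_\omega a\wedge b\}+\{a\wedge\partial_\omega b\},$$ where $x(a)=x\otimes a$ and $\kappa(x,y)=\tfrac12\mathrm{Tr}(\mathrm{ad}\,x\circ\mathrm{ad}\,y)$. The Lie algebra $\mathfrak{sl}_2=\mathfrak{sl}_2(K)$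 acts on it by the derivations $s\cdot x(a)=[s,x](a)$, $s\cdot\{\omega\}=0$, and hence on its second homology with trivial coefficients $$H_2(\mathfrak{sl}_2J)=\ker(\Lambda^2\,\mathfrak{sl}_2J\to\mathfrak{sl}_2J)\,/\,\mathrm{im}(\Lambda^3\,\mathfrak{sl}_2J\to\Lambda^2\,\mathfrak{sl}_2J).$$ **Proposition.** The $\mathfrak{sl}_2$-module $H_2(\mathfrak{sl}_2J(D))$ is isotypical of type $L(4)$, the simple $\mathfrak{sl}_2$-module of dimension $5$: it has no trivial component, $H_2(\mathfrak{sl}_2J(D))^{\mathfrak{sl}_2}=0$; it has no adjoint component, $H_2(\mathfrak{sl}_2J(D))^{\mathrm{ad}}=0$; and it is the sum of its submodules isomorphic to $L(4)$. -/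

import Mathlib

open scoped TensorProduct

noncomputable section

set_option linter.unusedSectionVars false

universe u v

/-! ### Second exterior powers -/

section Exterior

theorem update_pair_zero {A : Type*} (x y z : A) : Function.update ![x, y] 0 z = ![z, y] := by
  ext i; fin_cases i <;> rfl

theorem update_pair_one {A : Type*} (x y z : A) : Function.update ![x, y] 1 z = ![x, z] := by
  ext i; fin_cases i <;> rfl

variable {K : Type u} [Field K] {M N : Type*} [AddCommGroup M] [Module K M]
  [AddCommGroup N] [Module K N]

variable (K M) in
/-- The second exterior power `Λ² M`. -/
def Ext₂ : Type _ := ⋀[K]^2 M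

instance : AddCommGroup (Ext₂ K M) := inferInstanceAs (AddCommGroup (⋀[K]^2 M))

instance : Module K (Ext₂ K M) := inferInstanceAs (Module K (⋀[K]^2 M))

/-- The bilinear map `(x, y) ↦ x ∧ y` with values in `Λ² M`. -/
def wedge : M →ₗ[K] M →ₗ[K] Ext₂ K M :=
  LinearMap.mk₂ K (fun x y => (exteriorPower.ιMulti K 2 ![x, y] : ⋀[K]^2 M))
    (fun x x' y => by
      have := (exteriorPower.ιMulti K 2 (M := M)).map_update_add ![x, y] 0 x x'
      rw [update_pair_zero, update_pair_zero, update_pair_zero] at this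
      exact this)
    (fun c x y => by
      have := (exteriorPower.ιMulti K 2 (M := M)).map_update_smul ![x, y] 0 c x
      rw [update_pair_zero, update_pair_zero] at this
      exact this)
    (fun x y y' => by
      have := (exteriorPower.ιMulti K 2 (M := M)).map_update_add ![x, y] 1 y y'
      rw [update_pair_one, update_pair_one, update_pair_one] at this
      exact this)
    (fun c x y => by
      have := (exteriorPower.ιMulti K 2 (M := M)).map_update_smul ![x, y] 1 c y
      rw [update_pair_one, update_pair_one] at this
      exact this)

theorem wedge_apply (x y : M) :
    wedge (K := K) x y = (exteriorPower.ιMulti K 2 ![x, y] : ⋀[K]^2 M) := rfl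

theorem wedge_self (x : M) : wedge (K := K) x x = 0 :=
  (exteriorPower.ιMulti K 2 (M := M)).map_eq_zero_of_eq ![x, x] (i := 0) (j := 1) (by simp)
    (by simp)

theorem wedge_swap (x y : M) : wedge (K := K) y x = -wedge (K := K) x y := by
  have h := wedge_self (K := K) (x + y)
  simp only [map_add, LinearMap.add_apply, wedge_self, zero_add, add_zero] at h
  exact eq_neg_of_add_eq_zero_left h

/-- The linear map `Λ² M → N`, `x ∧ y ↦ f x y`, attached to an alternating bilinear map `f`. -/
def wedgeLift (f : M →ₗ[K] M →ₗ[K] N) (hf : ∀ x, f x x = 0) : Ext₂ K M →ₗ[K] N :=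
  show ⋀[K]^2 M →ₗ[K] N from exteriorPower.alternatingMapLinearEquiv
    { toFun := fun v => f (v 0) (v 1)
      map_update_add' := by
        intro _ v i x y
        fin_cases i <;> simp [Function.update]
      map_update_smul' := by
        intro _ v i c x
        fin_cases i <;> simp [Function.update]
      map_eq_zero_of_eq' := by
        intro v i j h hij
        fin_cases i <;> fin_cases j <;> simp_all }

@[simp]
theorem wedgeLift_wedge (f : M →ₗ[K] M →ₗ[K] N) (hf : ∀ x, f x x = 0) (x y : M) :
    wedgeLift f hf (wedge (K := K) x y) = f x y :=
  (exteriorPower.alternatingMapLinearEquiv_apply_ιMulti (R := K) _ ![x, y]).trans rfl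

theorem wedge_induction {p : Ext₂ K M → Prop} (z : Ext₂ K M)
    (hw : ∀ x y, p (wedge (K := K) x y)) (ha : ∀ a b, p a → p b → p (a + b))
    (hs : ∀ (c : K) a, p a → p (c • a)) : p z := by
  change ⋀[K]^2 M at z
  have hz : z ∈ Submodule.span K (Set.range (exteriorPower.ιMulti K 2 (M := M))) := by
    rw [exteriorPower.ιMulti_span]; trivial
  induction hz using Submodule.span_induction with
  | mem x h =>
    obtain ⟨v, rfl⟩ := h
    have : v = ![v 0, v 1] := by ext i; fin_cases i <;> rfl
    rw [this]; exact hw _ _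
  | zero => have := hs 0 _ (hw 0 0); rw [zero_smul] at this; exact this
  | add x y _ _ hx hy => exact ha _ _ hx hy
  | smul c x _ hx => exact hs _ _ hx

/-- The action of an endomorphism `f` of `M` on `Λ² M` as a derivation:
`x ∧ y ↦ f x ∧ y + x ∧ f y`. -/
def wedgeDer : Module.End K M →ₗ[K] Module.End K (Ext₂ K M) where
  toFun f := wedgeLift (wedge.comp f + wedge.compl₂ f) (fun x => by
    simp only [LinearMap.add_apply, LinearMap.comp_apply, LinearMap.compl₂_apply]
    rw [wedge_swap x (f x)]; simp)
  map_add' f g := by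
    refine LinearMap.ext fun z => ?_
    induction z using wedge_induction with
    | hw x y => simp [LinearMap.compl₂_apply]; abel
    | ha a b ha hb => rw [map_add, map_add, ha, hb]
    | hs c a ha => rw [map_smul, map_smul, ha]
  map_smul' r f := by
    refine LinearMap.ext fun z => ?_
    induction z using wedge_induction with
    | hw x y => simp [LinearMap.compl₂_apply]
    | ha a b ha hb => rw [map_add, map_add, ha, hb]
    | hs c a ha => rw [map_smul, map_smul, ha]

theorem wedgeDer_wedge (f : Module.End K M) (x y : M) :
    wedgeDer f (wedge (K := K) x y) = wedge (K := K) (f x) y + wedge (K := K) x (f y) := by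
  simp [wedgeDer, LinearMap.compl₂_apply]

theorem wedgeDer_lie (f g : Module.End K M) : wedgeDer ⁅f, g⁆ = ⁅wedgeDer f, wedgeDer g⁆ := by
  refine LinearMap.ext fun z => ?_
  induction z using wedge_induction with
  | hw x y =>
    simp only [Ring.lie_def, LinearMap.sub_apply, Module.End.mul_apply, wedgeDer_wedge, map_add,
      map_sub]
    abel
  | ha a b ha hb => rw [map_add, map_add, ha, hb]
  | hs c a ha => rw [map_smul, map_smul, ha]

end Exterior

/-! ### Second homology of a Lie algebra (trivial coefficients) -/

section Homology

variable (K : Type u) [Field K] (L : Type*) [LieRing L] [LieAlgebra K L]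

/-- The Chevalley-Eilenberg differential `Λ² L → L`, `x ∧ y ↦ ⁅x, y⁆`. -/
def ceD₂ : Ext₂ K L →ₗ[K] L :=
  wedgeLift (LieModule.toEnd K L L : L →ₗ[K] Module.End K L) (fun x => by simp)

@[simp]
theorem ceD₂_wedge (x y : L) : ceD₂ K L (wedge (K := K) x y) = ⁅x, y⁆ := by
  simp [ceD₂]

/-- The Chevalley-Eilenberg differential `Λ³ L → Λ² L`,
`x ∧ y ∧ z ↦ ⁅x, y⁆ ∧ z - ⁅x, z⁆ ∧ y + ⁅y, z⁆ ∧ x`. -/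
def ceD₃ : ⋀[K]^3 L →ₗ[K] Ext₂ K L :=
  exteriorPower.alternatingMapLinearEquiv
    { toFun := fun v => wedge (K := K) ⁅v 0, v 1⁆ (v 2) - wedge (K := K) ⁅v 0, v 2⁆ (v 1)
        + wedge (K := K) ⁅v 1, v 2⁆ (v 0)
      map_update_add' := by
        intro inst v i x y
        obtain rfl : inst = instDecidableEqFin 3 := Subsingleton.elim _ _
        fin_cases i <;> simp [Function.update] <;> abel
      map_update_smul' := by
        intro inst v i c x
        obtain rfl : inst = instDecidableEqFin 3 := Subsingleton.elim _ _
        fin_cases i <;> simp [Function.update, smul_add, smul_sub]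
      map_eq_zero_of_eq' := by
        intro v i j h hij
        have hs : ∀ x y z : L, wedge (K := K) ⁅y, x⁆ z = -wedge (K := K) ⁅x, y⁆ z := fun x y z => by
          rw [← lie_skew, map_neg, LinearMap.neg_apply]
        fin_cases i <;> fin_cases j <;> simp at h hij <;> simp [h]
        · rw [hs (v 2) (v 1)]; simp
        · rw [hs (v 1) (v 0)]; simp }

theorem ceD₃_apply (x y z : L) :
    ceD₃ K L (exteriorPower.ιMulti K 3 ![x, y, z]) =
      wedge (K := K) ⁅x, y⁆ z - wedge (K := K) ⁅x, z⁆ y + wedge (K := K) ⁅y, z⁆ x := by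
  simp [ceD₃]

variable {K L} in
theorem triple_induction {p : ⋀[K]^3 L → Prop} (w : ⋀[K]^3 L)
    (hw : ∀ x y z, p (exteriorPower.ιMulti K 3 ![x, y, z])) (ha : ∀ a b, p a → p b → p (a + b))
    (hs : ∀ (c : K) a, p a → p (c • a)) : p w := by
  have hz : w ∈ Submodule.span K (Set.range (exteriorPower.ιMulti K 3 (M := L))) := by
    rw [exteriorPower.ιMulti_span]; trivial
  induction hz using Submodule.span_induction with
  | mem x h =>
    obtain ⟨v, rfl⟩ := h
    have : v = ![v 0, v 1, v 2] := by ext i; fin_cases i <;> rfl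
    rw [this]; exact hw _ _ _
  | zero => simpa using hs 0 _ (hw 0 0 0)
  | add x y _ _ hx hy => exact ha _ _ hx hy
  | smul c x _ hx => exact hs _ _ hx

theorem ceD₂_ceD₃ (w : ⋀[K]^3 L) : ceD₂ K L (ceD₃ K L w) = 0 := by
  induction w using triple_induction with
  | hw x y z =>
    rw [ceD₃_apply]
    simp only [map_add, map_sub, ceD₂_wedge]
    have := lie_jacobi x y z
    rw [← lie_skew x ⁅y, z⁆, ← lie_skew y ⁅z, x⁆, ← lie_skew z ⁅x, y⁆,
      ← lie_skew z x, neg_lie, neg_neg] at this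
    rw [← neg_eq_zero, ← this]
    abel
  | ha a b ha hb => rw [map_add, map_add, ha, hb, add_zero]
  | hs c a ha => rw [map_smul, map_smul, ha, smul_zero]

/-- The space of two-cycles. -/
abbrev cycles₂ : Submodule K (Ext₂ K L) := LinearMap.ker (ceD₂ K L)

/-- The space of two-boundaries, inside the space of two-cycles. -/
abbrev boundaries₂ : Submodule K (cycles₂ K L) :=
  (LinearMap.range (ceD₃ K L)).comap (cycles₂ K L).subtype

/-- The second homology `H₂(L) = H₂(L, K)`: the kernel of `Λ² L → L` modulo the image of
`Λ³ L → Λ² L`. -/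
def H₂ : Type _ := (cycles₂ K L) ⧸ (boundaries₂ K L)

instance : AddCommGroup (H₂ K L) := inferInstanceAs (AddCommGroup ((cycles₂ K L) ⧸ (boundaries₂ K L)))

instance : Module K (H₂ K L) := inferInstanceAs (Module K ((cycles₂ K L) ⧸ (boundaries₂ K L)))

/-- The homology class of a two-cycle. -/
def H₂.mk : cycles₂ K L →ₗ[K] H₂ K L := (boundaries₂ K L).mkQ

variable {K L}

theorem ceD₂_wedgeDer (δ : LieDerivation K L L) (z : Ext₂ K L) :
    ceD₂ K L (wedgeDer (δ : L →ₗ[K] L) z) = δ (ceD₂ K L z) := by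
  induction z using wedge_induction with
  | hw x y =>
    rw [wedgeDer_wedge, map_add, ceD₂_wedge, ceD₂_wedge, ceD₂_wedge,
      LieDerivation.apply_lie_eq_add, add_comm]
    rfl
  | ha a b ha hb => simp only [map_add, ha, hb]
  | hs c a ha => simp only [map_smul, ha]

theorem wedgeDer_ceD₃_mem (δ : LieDerivation K L L) (w : ⋀[K]^3 L) :
    wedgeDer (δ : L →ₗ[K] L) (ceD₃ K L w) ∈ LinearMap.range (ceD₃ K L) := by
  induction w using triple_induction with
  | hw x y z =>
    refine ⟨exteriorPower.ιMulti K 3 ![δ x, y, z] + exteriorPower.ιMulti K 3 ![x, δ y, z]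
      + exteriorPower.ιMulti K 3 ![x, y, δ z], ?_⟩
    simp only [map_add, map_sub, ceD₃_apply, wedgeDer_wedge, LieDerivation.coeFn_coe,
      LieDerivation.apply_lie_eq_add, LinearMap.add_apply]
    abel
  | ha a b ha hb => simp only [map_add]; exact add_mem ha hb
  | hs c a ha => simp only [map_smul]; exact Submodule.smul_mem _ _ ha

/-- The action of a derivation of `L` on the two-cycles. -/
def cycleDer (δ : LieDerivation K L L) :
    cycles₂ K L →ₗ[K] cycles₂ K L :=
  (wedgeDer (δ : L →ₗ[K] L)).restrict (fun z hz => by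
    rw [LinearMap.mem_ker] at hz ⊢
    rw [ceD₂_wedgeDer, hz, map_zero])

/-- The action of a derivation `δ` of `L` on `H₂(L)`, induced by
`x ∧ y ↦ δ x ∧ y + x ∧ δ y`. -/
def H₂.der (δ : LieDerivation K L L) : H₂ K L →ₗ[K] H₂ K L :=
  Submodule.mapQ _ _ (cycleDer δ) (by
    rintro ⟨z, hz⟩ ⟨w, hw⟩
    have := wedgeDer_ceD₃_mem δ w
    rw [hw] at this
    exact this)

theorem H₂.der_mk (δ : LieDerivation K L L) (z : cycles₂ K L) :
    H₂.der δ (H₂.mk K L z) = H₂.mk K L (cycleDer δ z) := rfl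

theorem H₂.mk_surjective : Function.Surjective (H₂.mk K L) := Submodule.mkQ_surjective _

theorem H₂.der_add (δ ε : LieDerivation K L L) (c : H₂ K L) :
    H₂.der (δ + ε) c = H₂.der δ c + H₂.der ε c := by
  obtain ⟨z, rfl⟩ := H₂.mk_surjective c
  rw [H₂.der_mk, H₂.der_mk, H₂.der_mk, ← map_add]
  congr 1
  exact Subtype.ext (LinearMap.congr_fun (map_add wedgeDer (δ : L →ₗ[K] L) (ε : L →ₗ[K] L)) z.1)

theorem H₂.der_smul (r : K) (δ : LieDerivation K L L) (c : H₂ K L) :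
    H₂.der (r • δ) c = r • H₂.der δ c := by
  obtain ⟨z, rfl⟩ := H₂.mk_surjective c
  rw [H₂.der_mk, H₂.der_mk, ← map_smul]
  congr 1
  exact Subtype.ext (LinearMap.congr_fun (map_smul wedgeDer r (δ : L →ₗ[K] L)) z.1)

theorem H₂.der_lie (δ ε : LieDerivation K L L) (c : H₂ K L) :
    H₂.der ⁅δ, ε⁆ c = H₂.der δ (H₂.der ε c) - H₂.der ε (H₂.der δ c) := by
  obtain ⟨z, rfl⟩ := H₂.mk_surjective c
  rw [H₂.der_mk, H₂.der_mk, H₂.der_mk, H₂.der_mk, H₂.der_mk, ← map_sub]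
  congr 1
  refine Subtype.ext ?_
  have h := LinearMap.congr_fun (wedgeDer_lie (K := K) (δ : L →ₗ[K] L) (ε : L →ₗ[K] L)) z.1
  rw [← LieDerivation.commutator_coe_linear_map] at h
  exact h

end Homology

/-! ### Jordan algebras -/

section Jordan

variable (K : Type u) [Field K] (J : Type v) [NonUnitalNonAssocCommRing J] [Module K J]
  [SMulCommClass K J J] [IsScalarTower K J J]

/-- The map `∂ a b : z ↦ a (z b) - (a z) b`, bilinear in `a` and `b`. -/
def jordanDer : J →ₗ[K] J →ₗ[K] Module.End K J :=
  LinearMap.mk₂ K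
    (fun a b =>
      { toFun := fun z => a * (z * b) - (a * z) * b
        map_add' := by intros; simp only [add_mul, mul_add]; abel
        map_smul' := by intros; simp [smul_mul_assoc, mul_smul_comm, smul_sub] })
    (by intros; ext; simp [add_mul]; abel)
    (by intros; ext; simp [smul_mul_assoc, smul_sub])
    (by intros; ext; simp [mul_add]; abel)
    (by intros; ext; simp [mul_smul_comm, smul_sub])

@[simp]
theorem jordanDer_apply (a b z : J) : jordanDer K J a b z = a * (z * b) - (a * z) * b := rfl

/-- The subspace `R(J)` of `Λ² J` spanned by all `a ∧ a²`. -/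
def relR : Submodule K (Ext₂ K J) :=
  Submodule.span K (Set.range fun a : J => wedge (K := K) a (a * a))

/-- The space `ℬJ = Λ² J / R(J)`. -/
abbrev BJ : Type _ := (Ext₂ K J) ⧸ relR K J

variable {J} in
/-- The class `{a ∧ b}` in `ℬJ`, as a bilinear map. -/
def curly : J →ₗ[K] J →ₗ[K] BJ K J := wedge.compr₂ (relR K J).mkQ

variable {K J}

theorem curly_def (a b : J) : curly K a b = (relR K J).mkQ (wedge (K := K) a b) := rfl

theorem curly_self_sq (a : J) : curly K a (a * a) = 0 := by
  rw [curly_def, Submodule.mkQ_apply, Submodule.Quotient.mk_eq_zero]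
  exact Submodule.subset_span ⟨a, rfl⟩

theorem curly_self (a : J) : curly K a a = 0 := by rw [curly_def, wedge_self, map_zero]

theorem curly_swap (a b : J) : curly K b a = -curly K a b := by
  rw [curly_def, curly_def, wedge_swap, map_neg]

theorem BJ_induction {p : BJ K J → Prop} (w : BJ K J) (hc : ∀ a b, p (curly K a b))
    (ha : ∀ a b, p a → p b → p (a + b)) (hs : ∀ (c : K) a, p a → p (c • a)) : p w := by
  obtain ⟨z, rfl⟩ := (relR K J).mkQ_surjective w
  induction z using wedge_induction with
  | hw x y => exact hc x y
  | ha a b h h' => rw [map_add]; exact ha _ _ h h'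
  | hs c a h => rw [map_smul]; exact hs _ _ h

/-- The linearisation `{a ∧ bc} + {b ∧ ca} + {c ∧ ab} = 0` of `{a ∧ a²} = 0`. -/
theorem curly_cyclic [CharZero K] (a b c : J) :
    curly K a (b * c) + curly K b (c * a) + curly K c (a * b) = 0 := by
  have h1 := curly_self_sq (K := K) (a + b + c)
  have h2 := curly_self_sq (K := K) (a + b)
  have h3 := curly_self_sq (K := K) (b + c)
  have h4 := curly_self_sq (K := K) (a + c)
  have h5 := curly_self_sq (K := K) a
  have h6 := curly_self_sq (K := K) b
  have h7 := curly_self_sq (K := K) c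
  simp only [add_mul, mul_add, map_add, LinearMap.add_apply, mul_comm b a, mul_comm c a,
    mul_comm c b] at h1 h2 h3 h4
  rw [mul_comm c a]
  have : (2 : K) • (curly K a (b * c) + curly K b (a * c) + curly K c (a * b)) = 0 := by
    rw [two_smul]
    linear_combination (norm := abel) h1 - h2 - h3 - h4 + h5 + h6 + h7
  exact (smul_eq_zero.mp this).resolve_left two_ne_zero

/-- The linearised Jordan identity. -/
theorem jordan_linearised [CharZero K] [IsCommJordan J] (a b c d : J) :
    a * ((b * c) * d) - (b * c) * (a * d) + (b * ((c * a) * d) - (c * a) * (b * d))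
      + (c * ((a * b) * d) - (a * b) * (c * d)) = 0 := by
  have h := DFunLike.congr_fun (two_nsmul_lie_lmul_lmul_add_add_eq_zero a b c) d
  have h2 : (2 : K) • (a * ((b * c) * d) - (b * c) * (a * d) +
      (b * ((c * a) * d) - (c * a) * (b * d)) + (c * ((a * b) * d) - (a * b) * (c * d))) = 0 := by
    rw [two_smul, ← two_nsmul]
    exact h
  exact (smul_eq_zero.mp h2).resolve_left two_ne_zero

/-- `∂ a b` is a derivation. -/
theorem jordanDer_mul [CharZero K] [IsCommJordan J] (a b x y : J) :
    jordanDer K J a b (x * y) = jordanDer K J a b x * y + x * jordanDer K J a b y := by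
  have h1 := jordan_linearised (K := K) x y a b
  have h2 := jordan_linearised (K := K) x y b a
  simp only [jordanDer_apply, sub_mul, mul_sub]
  simp only [mul_comm] at h1 h2 ⊢
  linear_combination (norm := abel) h1 - h2

end Jordan

/-! ### The Lie algebra `𝔰𝔩₂` -/

section SL2

/-- The Lie algebra `𝔰𝔩₂(K)` of traceless two-by-two matrices. -/
abbrev sl2 (K : Type u) [Field K] : Type u := ↥(LieAlgebra.SpecialLinear.sl (Fin 2) K)

variable (K : Type u) [Field K]

/-- The invariant form `κ(x, y) = ½ Tr (ad x ∘ ad y)` on `𝔰𝔩₂`. -/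
def kappa : sl2 K →ₗ[K] sl2 K →ₗ[K] K := (2⁻¹ : K) • killingForm K (sl2 K)

/-- The bracket of `𝔰𝔩₂` as a bilinear map. -/
def sl2Lie : sl2 K →ₗ[K] sl2 K →ₗ[K] sl2 K :=
  (LieModule.toEnd K (sl2 K) (sl2 K) : sl2 K →ₗ[K] Module.End K (sl2 K))

variable {K}

@[simp]
theorem sl2Lie_apply (x y : sl2 K) : sl2Lie K x y = ⁅x, y⁆ := rfl

theorem sl2_trace (x : sl2 K) : x.1.trace = 0 := by
  have h : x.1 ∈ LinearMap.ker (Matrix.traceLinearMap (Fin 2) K K) := x.2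
  simpa using h

theorem sl2_entry (x : sl2 K) : x.1 1 1 = -x.1 0 0 := by
  have h := sl2_trace x
  rw [Matrix.trace_fin_two] at h
  exact eq_neg_of_add_eq_zero_right h

theorem sl2_double_lie (x y z : sl2 K) :
    ⁅x, ⁅y, z⁆⁆ = (2 * (x.1 * y.1).trace) • z - (2 * (x.1 * z.1).trace) • y := by
  apply Subtype.ext
  have hz : ((2 * (x.1 * y.1).trace) • z - (2 * (x.1 * z.1).trace) • y : sl2 K).1 =
      (2 * (x.1 * y.1).trace) • z.1 - (2 * (x.1 * z.1).trace) • y.1 := rfl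
  rw [hz, LieAlgebra.SpecialLinear.sl_bracket, LieAlgebra.SpecialLinear.sl_bracket,
    Matrix.trace_fin_two, Matrix.trace_fin_two]
  have hx := sl2_entry x
  have hy := sl2_entry y
  have hz := sl2_entry z
  ext i j
  fin_cases i <;> fin_cases j <;>
    simp [Matrix.mul_apply, Fin.sum_univ_two, hx, hy, hz] <;> ring

variable (K) in
theorem sl2_finrank : Module.finrank K (sl2 K) = 3 := by
  have h := LinearMap.finrank_range_add_finrank_ker (Matrix.traceLinearMap (Fin 2) K K)
  have hs : Function.Surjective (Matrix.traceLinearMap (Fin 2) K K) := fun c =>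
    ⟨Matrix.diagonal ![c, 0], by simp⟩
  rw [LinearMap.range_eq_top.mpr hs, finrank_top, Module.finrank_self,
    Module.finrank_matrix] at h
  have h' : Module.finrank K (sl2 K) =
    Module.finrank K (LinearMap.ker (Matrix.traceLinearMap (Fin 2) K K)) := rfl
  rw [h']
  simp at h
  omega

/-- `κ(x, y) = 2 Tr (x y)`; in particular `κ(h, h) = 4`. -/
theorem kappa_eq [CharZero K] (x y : sl2 K) : kappa K x y = 2 * (x.1 * y.1).trace := by
  let t : sl2 K →ₗ[K] K := 2 •
    ((Matrix.traceLinearMap (Fin 2) K K).comp (LinearMap.mulLeft K x.1)).comp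
      (show sl2 K →ₗ[K] Matrix (Fin 2) (Fin 2) K from
        (LinearMap.ker (Matrix.traceLinearMap (Fin 2) K K)).subtype)
  have ht' : ∀ z, t z = 2 * (x.1 * z.1).trace := fun z => by
    change 2 • (x.1 * z.1).trace = _
    rw [nsmul_eq_mul]; norm_num
  have h : LieModule.toEnd K (sl2 K) (sl2 K) x ∘ₗ LieModule.toEnd K (sl2 K) (sl2 K) y =
      (2 * (x.1 * y.1).trace) • LinearMap.id - t.smulRight y := by
    refine LinearMap.ext fun z => ?_
    have ht := ht' z
    simp only [LinearMap.comp_apply, LieModule.toEnd_apply_apply, sl2_double_lie,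
      LinearMap.sub_apply, LinearMap.smul_apply, LinearMap.id_apply, LinearMap.smulRight_apply, ht]
  have ht : t y = 2 * (x.1 * y.1).trace := ht' y
  rw [kappa, LinearMap.smul_apply, LinearMap.smul_apply, killingForm, LieModule.traceForm_apply_apply, h,
    map_sub, map_smul, LinearMap.trace_id, sl2_finrank, LinearMap.trace_smulRight, ht]
  simp only [smul_eq_mul]
  push_cast
  field_simp
  ring

theorem kappa_swap [CharZero K] (x y : sl2 K) : kappa K y x = kappa K x y := by
  rw [kappa_eq, kappa_eq, Matrix.trace_mul_comm]

theorem kappa_lie [CharZero K] (x y z : sl2 K) : kappa K ⁅x, y⁆ z = kappa K x ⁅y, z⁆ := by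
  rw [kappa_eq, kappa_eq, LieAlgebra.SpecialLinear.sl_bracket,
    LieAlgebra.SpecialLinear.sl_bracket, sub_mul, mul_sub, Matrix.trace_sub, Matrix.trace_sub,
    Matrix.mul_assoc, Matrix.mul_assoc, Matrix.trace_mul_comm y.1, Matrix.mul_assoc]

theorem sl2_double_lie' [CharZero K] (x y z : sl2 K) :
    ⁅x, ⁅y, z⁆⁆ = kappa K x y • z - kappa K x z • y := by
  rw [sl2_double_lie, kappa_eq, kappa_eq]

end SL2

/-! ### The Tits-Allison-Gao construction -/

section JordanAction

variable {K : Type u} [Field K] [CharZero K] {J : Type v} [NonUnitalNonAssocCommRing J] [Module K J]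
  [SMulCommClass K J J] [IsScalarTower K J J] [IsCommJordan J]

/-- `∂ a a² = 0`, by the Jordan identity. -/
theorem jordanDer_self_sq (a : J) : jordanDer K J a (a * a) = 0 := by
  refine LinearMap.ext fun z => ?_
  rw [jordanDer_apply, IsCommJordan.lmul_comm_rmul_rmul, sub_self, LinearMap.zero_apply]

theorem jordanDer_self (a : J) : jordanDer K J a a = 0 := by
  refine LinearMap.ext fun z => ?_
  rw [jordanDer_apply, mul_comm (a * z) a, mul_comm a z, sub_self, LinearMap.zero_apply]

variable (K J) in
/-- The natural map `ℬJ → Inner J ⊆ End J`, `{ω} ↦ ∂ ω`. -/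
def bDer : BJ K J →ₗ[K] Module.End K J :=
  (relR K J).liftQ
    (wedgeLift (jordanDer K J) jordanDer_self)
    (by
      rw [relR, Submodule.span_le]
      rintro _ ⟨a, rfl⟩
      rw [SetLike.mem_coe, LinearMap.mem_ker, wedgeLift_wedge, jordanDer_self_sq])

@[simp]
theorem bDer_curly (a b : J) : bDer K J (curly K a b) = jordanDer K J a b :=
  wedgeLift_wedge (jordanDer K J) jordanDer_self a b

theorem bDer_mul (w : BJ K J) (x y : J) :
    bDer K J w (x * y) = bDer K J w x * y + x * bDer K J w y := by
  induction w using BJ_induction with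
  | hc a b => rw [bDer_curly, jordanDer_mul]
  | ha a b ha hb => simp only [map_add, LinearMap.add_apply, ha, hb, add_mul, mul_add]; abel
  | hs c a ha => simp only [map_smul, LinearMap.smul_apply, ha, smul_add, smul_mul_assoc,
      mul_smul_comm]

theorem wedgeDer_mem_relR (w : BJ K J) (z : Ext₂ K J) (hz : z ∈ relR K J) :
    wedgeDer (bDer K J w) z ∈ relR K J := by
  induction hz using Submodule.span_induction with
  | mem x h =>
    obtain ⟨a, rfl⟩ := h
    change wedgeDer (bDer K J w) (wedge (K := K) a (a * a)) ∈ relR K J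
    rw [← Submodule.Quotient.mk_eq_zero, ← Submodule.mkQ_apply, wedgeDer_wedge, map_add,
      ← curly_def, ← curly_def, bDer_mul, map_add]
    have h := curly_cyclic (K := K) (bDer K J w a) a a
    rw [mul_comm a (bDer K J w a)] at h ⊢
    rw [← h]; abel
  | zero => rw [map_zero]; exact zero_mem _
  | add x y _ _ hx hy => rw [map_add]; exact add_mem hx hy
  | smul c x _ hx => rw [map_smul]; exact Submodule.smul_mem _ _ hx

variable (K J) in
/-- The action of `ℬJ` on itself: `{ω} · {a ∧ b} = {∂ ω a ∧ b} + {a ∧ ∂ ω b}`. -/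
def bAct : BJ K J →ₗ[K] BJ K J →ₗ[K] BJ K J where
  toFun w := Submodule.mapQ _ _ (wedgeDer (bDer K J w)) (wedgeDer_mem_relR w)
  map_add' w w' := by
    refine LinearMap.ext fun z => ?_
    obtain ⟨z, rfl⟩ := (relR K J).mkQ_surjective z
    simp only [Submodule.mkQ_apply, Submodule.mapQ_apply, LinearMap.add_apply, map_add,
      Submodule.Quotient.mk_add]
  map_smul' c w := by
    refine LinearMap.ext fun z => ?_
    obtain ⟨z, rfl⟩ := (relR K J).mkQ_surjective z
    simp only [Submodule.mkQ_apply, Submodule.mapQ_apply, LinearMap.smul_apply, map_smul,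
      Submodule.Quotient.mk_smul, RingHom.id_apply]

theorem bAct_curly (w : BJ K J) (a b : J) :
    bAct K J w (curly K a b) = curly K (bDer K J w a) b + curly K a (bDer K J w b) := by
  change (relR K J).mkQ (wedgeDer (bDer K J w) (wedge (K := K) a b)) = _
  rw [wedgeDer_wedge, map_add]; rfl

theorem bAct_swap_aux (a b c d : J) :
    bAct K J (curly K a b) (curly K c d) + bAct K J (curly K c d) (curly K a b) = 0 := by
  simp only [bAct_curly, bDer_curly, jordanDer_apply, map_sub, LinearMap.sub_apply]
  have h1 := curly_cyclic (K := K) a d (b * c)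
  have h2 := curly_cyclic (K := K) b d (a * c)
  have h3 := curly_cyclic (K := K) a c (b * d)
  have h4 := curly_cyclic (K := K) b c (a * d)
  have s1 := curly_swap (K := K) d (a * (b * c))
  have s2 := curly_swap (K := K) d (b * (a * c))
  have s3 := curly_swap (K := K) b (c * (a * d))
  have s4 := curly_swap (K := K) b (d * (a * c))
  have s5 := curly_swap (K := K) (b * c) (a * d)
  have s6 := curly_swap (K := K) (a * c) (b * d)
  simp only [mul_comm] at h1 h2 h3 h4 s1 s2 s3 s4 s5 s6 ⊢
  linear_combination (norm := abel) s1 - s2 + s3 - s4 - h1 + h2 + h3 - h4 + s5 - s6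

theorem bAct_swap (w w' : BJ K J) : bAct K J w w' = -bAct K J w' w := by
  rw [eq_neg_iff_add_eq_zero]
  induction w using BJ_induction with
  | hc a b =>
    induction w' using BJ_induction with
    | hc c d => exact bAct_swap_aux a b c d
    | ha x y hx hy =>
      simp only [map_add, LinearMap.add_apply]
      rw [add_add_add_comm, hx, hy, add_zero]
    | hs c x hx =>
      simp only [map_smul, LinearMap.smul_apply]
      rw [← smul_add, hx, smul_zero]
  | ha x y hx hy =>
    simp only [map_add, LinearMap.add_apply]
    rw [add_add_add_comm, hx, hy, add_zero]
  | hs c x hx =>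
    simp only [map_smul, LinearMap.smul_apply]
    rw [← smul_add, hx, smul_zero]

theorem bDer_bAct (w w' : BJ K J) (x : J) :
    bDer K J (bAct K J w w') x = bDer K J w (bDer K J w' x) - bDer K J w' (bDer K J w x) := by
  induction w' using BJ_induction with
  | hc c d =>
    rw [bAct_curly, map_add]
    simp only [bDer_curly, LinearMap.add_apply, jordanDer_apply, map_sub, bDer_mul, add_mul,
      mul_add]
    abel
  | ha a b ha hb => simp only [map_add, LinearMap.add_apply, ha, hb]; abel
  | hs c a ha => simp only [map_smul, LinearMap.smul_apply, ha, smul_sub]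

theorem bAct_bAct (w w' z : BJ K J) :
    bAct K J (bAct K J w w') z = bAct K J w (bAct K J w' z) - bAct K J w' (bAct K J w z) := by
  induction z using BJ_induction with
  | hc c d =>
    simp only [bAct_curly, map_add, bDer_bAct, map_sub, LinearMap.sub_apply]
    abel
  | ha a b ha hb => simp only [map_add, ha, hb]; abel
  | hs c a ha => simp only [map_smul, ha, smul_sub]

end JordanAction

section TAG

variable (K : Type u) [Field K] (J : Type v) [NonUnitalNonAssocCommRing J] [Module K J]
  [SMulCommClass K J J] [IsScalarTower K J J]

/-- The space `TAG(J) = 𝔰𝔩₂ J = ℬJ ⊕ 𝔰𝔩₂ ⊗ J`. -/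
def TAG : Type (max u v) := BJ K J × (sl2 K ⊗[K] J)

instance : AddCommGroup (TAG K J) := inferInstanceAs (AddCommGroup (BJ K J × (sl2 K ⊗[K] J)))

instance : Module K (TAG K J) := inferInstanceAs (Module K (BJ K J × (sl2 K ⊗[K] J)))

/-- The inclusion of `ℬJ`. -/
def TAG.ofB : BJ K J →ₗ[K] TAG K J := LinearMap.inl K (BJ K J) (sl2 K ⊗[K] J)

/-- The inclusion of `𝔰𝔩₂ ⊗ J`. -/
def TAG.ofT : sl2 K ⊗[K] J →ₗ[K] TAG K J := LinearMap.inr K (BJ K J) (sl2 K ⊗[K] J)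

/-- The projection to `ℬJ`. -/
def TAG.fstB : TAG K J →ₗ[K] BJ K J := LinearMap.fst K (BJ K J) (sl2 K ⊗[K] J)

/-- The projection to `𝔰𝔩₂ ⊗ J`. -/
def TAG.sndT : TAG K J →ₗ[K] sl2 K ⊗[K] J := LinearMap.snd K (BJ K J) (sl2 K ⊗[K] J)

/-- The bilinear map `(x(a), y(b)) ↦ κ(x, y) {a ∧ b}`. -/
def kappaCurly : sl2 K ⊗[K] J →ₗ[K] sl2 K ⊗[K] J →ₗ[K] BJ K J :=
  (TensorProduct.map₂ (kappa K) (curly K)).compr₂ (TensorProduct.lid K (BJ K J)).toLinearMap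

/-- The bilinear map `(x(a), y(b)) ↦ [x, y](a b)`. -/
def lieMul : sl2 K ⊗[K] J →ₗ[K] sl2 K ⊗[K] J →ₗ[K] sl2 K ⊗[K] J :=
  TensorProduct.map₂ (sl2Lie K) (LinearMap.mul K J)

variable {K J}

theorem kappaCurly_tmul (x y : sl2 K) (a b : J) :
    kappaCurly K J (x ⊗ₜ a) (y ⊗ₜ b) = kappa K x y • curly K a b := by
  simp [kappaCurly]

theorem lieMul_tmul (x y : sl2 K) (a b : J) :
    lieMul K J (x ⊗ₜ a) (y ⊗ₜ b) = ⁅x, y⁆ ⊗ₜ (a * b) := by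
  simp [lieMul]

theorem TAG.induction {p : TAG K J → Prop} (X : TAG K J) (hB : ∀ w, p (TAG.ofB K J w))
    (hT : ∀ x a, p (TAG.ofT K J (x ⊗ₜ a))) (ha : ∀ X Y, p X → p Y → p (X + Y)) : p X := by
  have h : X = TAG.ofB K J X.1 + TAG.ofT K J X.2 := by
    refine Prod.ext ?_ ?_
    · exact (add_zero X.1).symm
    · exact (zero_add X.2).symm
  rw [h]
  refine ha _ _ (hB _) ?_
  generalize X.2 = t
  induction t using TensorProduct.induction_on with
  | zero => rw [map_zero, ← map_zero (TAG.ofB K J)]; exact hB 0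
  | tmul x a => exact hT x a
  | add s t hs ht => rw [map_add]; exact ha _ _ hs ht

variable [CharZero K] [IsCommJordan J]

variable (K J) in
/-- The map `ℬJ → End (𝔰𝔩₂ ⊗ J)`, `{ω} ↦ (x(a) ↦ x(∂ ω a))`. -/
def bDerT : BJ K J →ₗ[K] sl2 K ⊗[K] J →ₗ[K] sl2 K ⊗[K] J :=
  (LinearMap.lTensorHom (sl2 K)).comp (bDer K J)

theorem bDerT_tmul (w : BJ K J) (x : sl2 K) (a : J) :
    bDerT K J w (x ⊗ₜ a) = x ⊗ₜ (bDer K J w a) := rfl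

variable (K J) in
/-- The bracket of `TAG(J)`, as a bilinear map, determined by the rules
`[x(a), y(b)] = [x, y](a b) + κ(x, y) {a ∧ b}`, `[{ω}, x(a)] = x(∂ ω a) = -[x(a), {ω}]` and
`[{ω}, {ω'}] = ∂ ω · {ω'}`. -/
def TAG.lie : TAG K J →ₗ[K] TAG K J →ₗ[K] TAG K J :=
  ((bAct K J).compl₁₂ (TAG.fstB K J) (TAG.fstB K J)
      + (kappaCurly K J).compl₁₂ (TAG.sndT K J) (TAG.sndT K J)).compr₂ (TAG.ofB K J)
    + ((bDerT K J).compl₁₂ (TAG.fstB K J) (TAG.sndT K J)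
      - ((bDerT K J).compl₁₂ (TAG.fstB K J) (TAG.sndT K J)).flip
      + (lieMul K J).compl₁₂ (TAG.sndT K J) (TAG.sndT K J)).compr₂ (TAG.ofT K J)

section rules

variable (w w' : BJ K J) (x y : sl2 K) (a b : J)

theorem TAG.fstB_ofB : TAG.fstB K J (TAG.ofB K J w) = w := rfl
theorem TAG.sndT_ofB : TAG.sndT K J (TAG.ofB K J w) = 0 := rfl
theorem TAG.fstB_ofT (t : sl2 K ⊗[K] J) : TAG.fstB K J (TAG.ofT K J t) = 0 := rfl
theorem TAG.sndT_ofT (t : sl2 K ⊗[K] J) : TAG.sndT K J (TAG.ofT K J t) = t := rfl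

theorem TAG.lie_def (X Y : TAG K J) : TAG.lie K J X Y =
    TAG.ofB K J (bAct K J (TAG.fstB K J X) (TAG.fstB K J Y)
      + kappaCurly K J (TAG.sndT K J X) (TAG.sndT K J Y))
    + TAG.ofT K J (bDerT K J (TAG.fstB K J X) (TAG.sndT K J Y)
      - bDerT K J (TAG.fstB K J Y) (TAG.sndT K J X)
      + lieMul K J (TAG.sndT K J X) (TAG.sndT K J Y)) := rfl

theorem TAG.lie_BB : TAG.lie K J (TAG.ofB K J w) (TAG.ofB K J w') =
    TAG.ofB K J (bAct K J w w') := by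
  simp only [TAG.lie_def, TAG.fstB_ofB, TAG.sndT_ofB, map_zero, add_zero, sub_zero]

theorem TAG.lie_BT : TAG.lie K J (TAG.ofB K J w) (TAG.ofT K J (x ⊗ₜ a)) =
    TAG.ofT K J (x ⊗ₜ bDer K J w a) := by
  simp only [TAG.lie_def, TAG.fstB_ofB, TAG.sndT_ofB, TAG.fstB_ofT, TAG.sndT_ofT, map_zero,
    LinearMap.zero_apply, add_zero, zero_add, sub_zero, bDerT_tmul]

theorem TAG.lie_TB : TAG.lie K J (TAG.ofT K J (x ⊗ₜ a)) (TAG.ofB K J w) =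
    -TAG.ofT K J (x ⊗ₜ bDer K J w a) := by
  simp only [TAG.lie_def, TAG.fstB_ofB, TAG.sndT_ofB, TAG.fstB_ofT, TAG.sndT_ofT, map_zero,
    LinearMap.zero_apply, add_zero, zero_add, zero_sub, bDerT_tmul, map_neg]

theorem TAG.lie_TT : TAG.lie K J (TAG.ofT K J (x ⊗ₜ a)) (TAG.ofT K J (y ⊗ₜ b)) =
    TAG.ofT K J (⁅x, y⁆ ⊗ₜ (a * b)) + TAG.ofB K J (kappa K x y • curly K a b) := by
  simp only [TAG.lie_def, TAG.fstB_ofT, TAG.sndT_ofT, map_zero, LinearMap.zero_apply, zero_add,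
    sub_zero, kappaCurly_tmul, lieMul_tmul]
  rw [add_comm]

end rules

theorem TAG.lie_swap (X Y : TAG K J) : TAG.lie K J Y X = -TAG.lie K J X Y := by
  induction X using TAG.induction with
  | ha X X' hX hX' => simp only [map_add, LinearMap.add_apply, hX, hX', neg_add]
  | hB w =>
    induction Y using TAG.induction with
    | ha Y Y' hY hY' => simp only [map_add, LinearMap.add_apply, hY, hY', neg_add]
    | hB w' => rw [TAG.lie_BB, TAG.lie_BB, bAct_swap, map_neg]
    | hT y b => rw [TAG.lie_BT, TAG.lie_TB]
  | hT x a =>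
    induction Y using TAG.induction with
    | ha Y Y' hY hY' => simp only [map_add, LinearMap.add_apply, hY, hY', neg_add]
    | hB w' => rw [TAG.lie_BT, TAG.lie_TB, neg_neg]
    | hT y b =>
      rw [TAG.lie_TT, TAG.lie_TT, kappa_swap, curly_swap, mul_comm b a, ← lie_skew,
        TensorProduct.neg_tmul, smul_neg, map_neg, map_neg, neg_add]

theorem TAG.lie_self_eq_zero (X : TAG K J) : TAG.lie K J X X = 0 := by
  have h : (2 : K) • TAG.lie K J X X = 0 := by
    rw [two_smul]
    nth_rewrite 1 [TAG.lie_swap]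
    exact neg_add_cancel _
  exact (smul_eq_zero.mp h).resolve_left two_ne_zero

/-- The Jacobi identity for three elements of `𝔰𝔩₂ ⊗ J`. -/
theorem TAG.jacobi_TTT (x y z : sl2 K) (a b c : J) :
    TAG.lie K J (TAG.ofT K J (x ⊗ₜ a)) (TAG.lie K J (TAG.ofT K J (y ⊗ₜ b)) (TAG.ofT K J (z ⊗ₜ c))) =
    TAG.lie K J (TAG.lie K J (TAG.ofT K J (x ⊗ₜ a)) (TAG.ofT K J (y ⊗ₜ b))) (TAG.ofT K J (z ⊗ₜ c))
    + TAG.lie K J (TAG.ofT K J (y ⊗ₜ b))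
      (TAG.lie K J (TAG.ofT K J (x ⊗ₜ a)) (TAG.ofT K J (z ⊗ₜ c))) := by
  have hk : kappa K y ⁅x, z⁆ = -kappa K x ⁅y, z⁆ := by
    rw [← kappa_lie, ← lie_skew, map_neg, LinearMap.neg_apply, kappa_lie]
  have hxy : ⁅⁅x, y⁆, z⁆ = kappa K y z • x - kappa K x z • y := by
    rw [← lie_skew, sl2_double_lie', kappa_swap x z, kappa_swap y z, neg_sub]
  have hc := congrArg (fun t => kappa K x ⁅y, z⁆ • TAG.ofB K J t) (curly_cyclic (K := K) a b c)
  have hs := curly_swap (K := K) c (a * b)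
  simp only [TAG.lie_TT, map_add, LinearMap.add_apply, map_smul, LinearMap.smul_apply, TAG.lie_TB,
    TAG.lie_BT, bDer_curly, kappa_lie, hk, hxy, sl2_double_lie', kappa_swap x y, hs,
    TensorProduct.sub_tmul, jordanDer_apply, TensorProduct.tmul_sub, map_sub,
    ← TensorProduct.smul_tmul', map_neg, map_zero, smul_zero] at hc ⊢
  simp only [mul_comm] at hc ⊢
  linear_combination (norm := module) hc

theorem TAG.jacobi (X Y Z : TAG K J) :
    TAG.lie K J X (TAG.lie K J Y Z) =
      TAG.lie K J (TAG.lie K J X Y) Z + TAG.lie K J Y (TAG.lie K J X Z) := by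
  induction X using TAG.induction with
  | ha X X' hX hX' => simp only [map_add, LinearMap.add_apply, hX, hX']; abel
  | hB w =>
    induction Y using TAG.induction with
    | ha Y Y' hY hY' => simp only [map_add, LinearMap.add_apply, hY, hY']; abel
    | hB w' =>
      induction Z using TAG.induction with
      | ha Z Z' hZ hZ' => simp only [map_add, hZ, hZ']; abel
      | hB v => simp only [TAG.lie_BB, bAct_bAct]; simp
      | hT z c =>
        simp only [TAG.lie_BB, TAG.lie_BT, bDer_bAct, ← map_add, ← TensorProduct.tmul_add]; simp
    | hT y b =>
      induction Z using TAG.induction with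
      | ha Z Z' hZ hZ' => simp only [map_add, hZ, hZ']; abel
      | hB v =>
        simp only [TAG.lie_BB, TAG.lie_BT, TAG.lie_TB, bDer_bAct, map_neg,
          TensorProduct.tmul_sub, map_sub]
        abel
      | hT z c =>
        simp only [TAG.lie_TT, TAG.lie_BT, map_add, TAG.lie_BB, map_smul, bAct_curly, bDer_mul,
          TensorProduct.tmul_add, smul_add]
        abel
  | hT x a =>
    induction Y using TAG.induction with
    | ha Y Y' hY hY' => simp only [map_add, LinearMap.add_apply, hY, hY']; abel
    | hB w' =>
      induction Z using TAG.induction with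
      | ha Z Z' hZ hZ' => simp only [map_add, hZ, hZ']; abel
      | hB v =>
        simp only [TAG.lie_BB, TAG.lie_BT, TAG.lie_TB, bDer_bAct, map_neg, LinearMap.neg_apply,
          TensorProduct.tmul_sub, map_sub]
        abel
      | hT z c =>
        simp only [TAG.lie_TT, TAG.lie_BT, TAG.lie_TB, map_add, TAG.lie_BB, map_smul, bAct_curly,
          bDer_mul, TensorProduct.tmul_add, smul_add, map_neg, LinearMap.neg_apply]
        abel
    | hT y b =>
      induction Z using TAG.induction with
      | ha Z Z' hZ hZ' => simp only [map_add, hZ, hZ']; abel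
      | hB v =>
        rw [TAG.lie_TT, map_add, LinearMap.add_apply, TAG.lie_TB, TAG.lie_TB, TAG.lie_TB,
          TAG.lie_BB, bAct_swap, map_neg, map_neg, map_neg, map_smul, bAct_curly, TAG.lie_TT,
          TAG.lie_TT, bDer_mul, curly_swap _ b, kappa_swap x y, ← lie_skew x y, mul_comm b]
        simp only [TensorProduct.tmul_add, map_add, smul_add, TensorProduct.neg_tmul, map_neg,
          smul_neg]
        abel
      | hT z c => exact TAG.jacobi_TTT x y z a b c

instance : LieRing (TAG K J) where
  bracket X Y := TAG.lie K J X Y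
  add_lie X Y Z := by
    change TAG.lie K J (X + Y) Z = TAG.lie K J X Z + TAG.lie K J Y Z
    rw [map_add, LinearMap.add_apply]
  lie_add X Y Z := map_add (TAG.lie K J X) Y Z
  lie_self X := TAG.lie_self_eq_zero X
  leibniz_lie X Y Z := TAG.jacobi X Y Z

instance : LieAlgebra K (TAG K J) where
  lie_smul c X Y := map_smul (TAG.lie K J X) c Y

theorem TAG.bracket_def (X Y : TAG K J) : ⁅X, Y⁆ = TAG.lie K J X Y := rfl

end TAG

/-! ### The action of `𝔰𝔩₂` -/

section Action

variable (K : Type u) [Field K] [CharZero K] (J : Type v) [NonUnitalNonAssocCommRing J] [Module K J]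
  [SMulCommClass K J J] [IsScalarTower K J J] [IsCommJordan J]

/-- The endomorphism `s · x(a) = [s, x](a)`, `s · {ω} = 0` of `TAG(J)`. -/
def TAG.sl2Map (s : sl2 K) : TAG K J →ₗ[K] TAG K J :=
  (TAG.ofT K J) ∘ₗ (LinearMap.rTensor J (sl2Lie K s)) ∘ₗ (TAG.sndT K J)

variable {K J}

theorem TAG.sl2Map_ofB (s : sl2 K) (w : BJ K J) : TAG.sl2Map K J s (TAG.ofB K J w) = 0 := by
  simp only [TAG.sl2Map, LinearMap.comp_apply, TAG.sndT_ofB, map_zero]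

theorem TAG.sl2Map_ofT (s x : sl2 K) (a : J) :
    TAG.sl2Map K J s (TAG.ofT K J (x ⊗ₜ a)) = TAG.ofT K J (⁅s, x⁆ ⊗ₜ a) := rfl

theorem TAG.sl2Map_lie (s : sl2 K) (X Y : TAG K J) :
    TAG.sl2Map K J s ⁅X, Y⁆ = ⁅X, TAG.sl2Map K J s Y⁆ - ⁅Y, TAG.sl2Map K J s X⁆ := by
  induction X using TAG.induction with
  | ha X X' hX hX' => simp only [add_lie, lie_add, map_add, hX, hX']; abel
  | hB w =>
    induction Y using TAG.induction with
    | ha Y Y' hY hY' => simp only [add_lie, lie_add, map_add, hY, hY']; abel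
    | hB w' =>
      rw [TAG.bracket_def, TAG.lie_BB]
      simp only [TAG.sl2Map_ofB, lie_zero, sub_zero]
    | hT y b =>
      rw [TAG.bracket_def, TAG.lie_BT]
      simp only [TAG.sl2Map_ofB, TAG.sl2Map_ofT, lie_zero, sub_zero, TAG.bracket_def, TAG.lie_BT]
  | hT x a =>
    induction Y using TAG.induction with
    | ha Y Y' hY hY' => simp only [add_lie, lie_add, map_add, hY, hY']; abel
    | hB w' =>
      rw [TAG.bracket_def, TAG.lie_TB, map_neg]
      simp only [TAG.sl2Map_ofB, TAG.sl2Map_ofT, lie_zero, zero_sub, TAG.bracket_def, TAG.lie_BT]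
    | hT y b =>
      have hk : kappa K y ⁅s, x⁆ = -kappa K ⁅s, y⁆ x := by
        rw [← kappa_lie, ← lie_skew, map_neg, LinearMap.neg_apply]
      simp only [TAG.bracket_def, TAG.lie_TT, map_add, map_smul, TAG.sl2Map_ofB, TAG.sl2Map_ofT,
        smul_zero, add_zero]
      rw [hk, kappa_swap x, curly_swap a b, mul_comm b a, leibniz_lie s x y,
        ← lie_skew ⁅s, x⁆ y, TensorProduct.add_tmul, TensorProduct.neg_tmul, map_add, map_neg,
        map_neg (TAG.ofB K J)]
      module

/-- The action of `𝔰𝔩₂` on `TAG(J)` by derivations. -/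
def TAG.sl2Der (s : sl2 K) : LieDerivation K (TAG K J) (TAG K J) where
  toLinearMap := TAG.sl2Map K J s
  leibniz' := TAG.sl2Map_lie s

theorem TAG.sl2Der_ofB (s : sl2 K) (w : BJ K J) : TAG.sl2Der s (TAG.ofB K J w) = 0 :=
  TAG.sl2Map_ofB s w

theorem TAG.sl2Der_ofT (s x : sl2 K) (a : J) :
    TAG.sl2Der s (TAG.ofT K J (x ⊗ₜ a)) = TAG.ofT K J (⁅s, x⁆ ⊗ₜ a) := rfl

theorem TAG.sl2Der_add (s t : sl2 K) :
    (TAG.sl2Der (s + t) : LieDerivation K (TAG K J) (TAG K J)) = TAG.sl2Der s + TAG.sl2Der t := by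
  refine LieDerivation.ext fun X => ?_
  rw [LieDerivation.add_apply]
  induction X using TAG.induction with
  | ha X Y hX hY => simp only [map_add, hX, hY]; abel
  | hB w => simp only [TAG.sl2Der_ofB, add_zero]
  | hT x a => simp only [TAG.sl2Der_ofT, add_lie, TensorProduct.add_tmul, map_add]

theorem TAG.sl2Der_smul (c : K) (s : sl2 K) :
    (TAG.sl2Der (c • s) : LieDerivation K (TAG K J) (TAG K J)) = c • TAG.sl2Der s := by
  refine LieDerivation.ext fun X => ?_
  rw [LieDerivation.smul_apply]
  induction X using TAG.induction with
  | ha X Y hX hY => simp only [map_add, hX, hY, smul_add]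
  | hB w => simp only [TAG.sl2Der_ofB, smul_zero]
  | hT x a => simp only [TAG.sl2Der_ofT, smul_lie, ← TensorProduct.smul_tmul', map_smul]

theorem TAG.sl2Der_lie (s t : sl2 K) :
    (TAG.sl2Der ⁅s, t⁆ : LieDerivation K (TAG K J) (TAG K J)) =
      ⁅(TAG.sl2Der s : LieDerivation K (TAG K J) (TAG K J)), TAG.sl2Der t⁆ := by
  refine LieDerivation.ext fun X => ?_
  rw [LieDerivation.commutator_apply]
  induction X using TAG.induction with
  | ha X Y hX hY => simp only [map_add, hX, hY]; abel
  | hB w => simp only [TAG.sl2Der_ofB, map_zero, sub_zero]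
  | hT x a => simp only [TAG.sl2Der_ofT, lie_lie, TensorProduct.sub_tmul, map_sub]

/-- The `𝔰𝔩₂`-module structure on `H₂(TAG(J))` induced by the action of `𝔰𝔩₂` on `TAG(J)`. -/
instance : LieRingModule (sl2 K) (H₂ K (TAG K J)) where
  bracket s c := H₂.der (TAG.sl2Der s) c
  add_lie s t c := by
    change H₂.der (TAG.sl2Der (s + t)) c = H₂.der (TAG.sl2Der s) c + H₂.der (TAG.sl2Der t) c
    rw [TAG.sl2Der_add, H₂.der_add]
  lie_add s c c' := map_add (H₂.der (TAG.sl2Der s)) c c'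
  leibniz_lie s t c := by
    change H₂.der (TAG.sl2Der s) (H₂.der (TAG.sl2Der t) c) = H₂.der (TAG.sl2Der ⁅s, t⁆) c
      + H₂.der (TAG.sl2Der t) (H₂.der (TAG.sl2Der s) c)
    rw [TAG.sl2Der_lie, H₂.der_lie, sub_add_cancel]

instance : LieModule K (sl2 K) (H₂ K (TAG K J)) where
  smul_lie r s c := by
    change H₂.der (TAG.sl2Der (r • s)) c = r • H₂.der (TAG.sl2Der s) c
    rw [TAG.sl2Der_smul, H₂.der_smul]
  lie_smul r s c := map_smul (H₂.der (TAG.sl2Der s)) r c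

end Action

/-! ### The free Jordan algebra -/

section Free

variable (K : Type u) [Field K] (X : Type v)

/-- The relations of the free Jordan algebra: the congruence of the free non-associative algebra
is generated by commutativity and by the Jordan identity `x² (y x) = (x² y) x`. -/
inductive FreeJordan.Rel :
    FreeNonUnitalNonAssocAlgebra K X → FreeNonUnitalNonAssocAlgebra K X → Prop
  | comm (x y : FreeNonUnitalNonAssocAlgebra K X) : Rel (x * y) (y * x)
  | jordan (x y : FreeNonUnitalNonAssocAlgebra K X) :
      Rel ((x * x) * (y * x)) (((x * x) * y) * x)
  | smul (t : K) {a b : FreeNonUnitalNonAssocAlgebra K X} : Rel a b → Rel (t • a) (t • b)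
  | add_right {a b : FreeNonUnitalNonAssocAlgebra K X} (c : FreeNonUnitalNonAssocAlgebra K X) :
      Rel a b → Rel (a + c) (b + c)
  | mul_left (a : FreeNonUnitalNonAssocAlgebra K X) {b c : FreeNonUnitalNonAssocAlgebra K X} :
      Rel b c → Rel (a * b) (a * c)
  | mul_right {a b : FreeNonUnitalNonAssocAlgebra K X} (c : FreeNonUnitalNonAssocAlgebra K X) :
      Rel a b → Rel (a * c) (b * c)

/-- The free (non-unital) Jordan algebra over `K` on the set `X`. -/
def FreeJordan : Type (max u v) := Quot (FreeJordan.Rel K X)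

namespace FreeJordan

variable {K X}

theorem Rel.addLeft (a : FreeNonUnitalNonAssocAlgebra K X)
    {b c : FreeNonUnitalNonAssocAlgebra K X} (h : Rel K X b c) : Rel K X (a + b) (a + c) := by
  rw [add_comm _ b, add_comm _ c]; exact h.add_right _

theorem Rel.neg {a b : FreeNonUnitalNonAssocAlgebra K X} (h : Rel K X a b) :
    Rel K X (-a) (-b) := by
  simpa only [neg_one_smul] using h.smul (-1)

theorem Rel.subLeft (a : FreeNonUnitalNonAssocAlgebra K X)
    {b c : FreeNonUnitalNonAssocAlgebra K X} (h : Rel K X b c) : Rel K X (a - b) (a - c) := by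
  simpa only [sub_eq_add_neg] using h.neg.addLeft a

theorem Rel.subRight {a b : FreeNonUnitalNonAssocAlgebra K X}
    (c : FreeNonUnitalNonAssocAlgebra K X) (h : Rel K X a b) : Rel K X (a - c) (b - c) := by
  simpa only [sub_eq_add_neg] using h.add_right (-c)

theorem Rel.nsmul (n : ℕ) {a b : FreeNonUnitalNonAssocAlgebra K X} (h : Rel K X a b) :
    Rel K X (n • a) (n • b) := by
  simpa only [Nat.cast_smul_eq_nsmul] using h.smul (n : K)

theorem Rel.zsmul (n : ℤ) {a b : FreeNonUnitalNonAssocAlgebra K X} (h : Rel K X a b) :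
    Rel K X (n • a) (n • b) := by
  simpa only [Int.cast_smul_eq_zsmul] using h.smul (n : K)

instance : Zero (FreeJordan K X) where zero := Quot.mk _ 0

instance : Add (FreeJordan K X) where
  add := Quot.map₂ (· + ·) (fun _ _ _ => Rel.addLeft _) fun _ _ _ => Rel.add_right _

instance : Neg (FreeJordan K X) where neg := Quot.map Neg.neg fun _ _ => Rel.neg

instance : Sub (FreeJordan K X) where
  sub := Quot.map₂ Sub.sub (fun _ _ _ => Rel.subLeft _) fun _ _ _ => Rel.subRight _

instance : Mul (FreeJordan K X) where
  mul := Quot.map₂ (· * ·) (fun _ _ _ => Rel.mul_left _) fun _ _ _ => Rel.mul_right _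

instance : SMul K (FreeJordan K X) where smul t := Quot.map (t • ·) fun _ _ => Rel.smul t

instance : SMul ℕ (FreeJordan K X) where smul t := Quot.map (t • ·) fun _ _ => Rel.nsmul t

instance : SMul ℤ (FreeJordan K X) where smul t := Quot.map (t • ·) fun _ _ => Rel.zsmul t

instance : NonUnitalNonAssocRing (FreeJordan K X) :=
  Function.Surjective.nonUnitalNonAssocRing (Quot.mk (Rel K X)) Quot.mk_surjective rfl
    (fun _ _ => rfl) (fun _ _ => rfl) (fun _ => rfl) (fun _ _ => rfl) (fun _ _ => rfl)
    (fun _ _ => rfl)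

instance : NonUnitalNonAssocCommRing (FreeJordan K X) where
  mul_comm := by rintro ⟨a⟩ ⟨b⟩; exact Quot.sound (Rel.comm a b)

instance : IsCommJordan (FreeJordan K X) where
  lmul_comm_rmul_rmul := by
    intro a b
    have h : (a * a) * (b * a) = ((a * a) * b) * a := by
      induction a using Quot.ind
      induction b using Quot.ind
      exact Quot.sound (Rel.jordan _ _)
    rw [mul_comm (a * b), mul_comm a b, h, mul_comm _ a, mul_comm b]

instance : Module K (FreeJordan K X) :=
  Function.Surjective.module K ⟨⟨Quot.mk (Rel K X), rfl⟩, fun _ _ => rfl⟩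
    Quot.mk_surjective (fun _ _ => rfl)

instance : IsScalarTower K (FreeJordan K X) (FreeJordan K X) where
  smul_assoc := by
    rintro t ⟨a⟩ ⟨b⟩
    exact congrArg (Quot.mk (Rel K X)) (smul_mul_assoc t a b)

instance : SMulCommClass K (FreeJordan K X) (FreeJordan K X) where
  smul_comm := by
    rintro t ⟨a⟩ ⟨b⟩
    exact congrArg (Quot.mk (Rel K X)) (mul_smul_comm t a b).symm

variable (K) in
/-- The generators of the free Jordan algebra. -/
def of (x : X) : FreeJordan K X := Quot.mk _ (FreeNonUnitalNonAssocAlgebra.of K x)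

end FreeJordan

end Free

/-! ### Simple `𝔰𝔩₂`-modules and isotypic components -/

section Simple

variable (K : Type u) [Field K]

/-- The action of a matrix `s` on polynomials in two variables, as the derivation extending
its action `X j ↦ ∑ i, s i j • X i` on linear forms. -/
def polyDer (s : Matrix (Fin 2) (Fin 2) K) :
    Derivation K (MvPolynomial (Fin 2) K) (MvPolynomial (Fin 2) K) :=
  MvPolynomial.mkDerivation K fun j => ∑ i, s i j • MvPolynomial.X i

variable {K}

theorem polyDer_X (s : Matrix (Fin 2) (Fin 2) K) (j : Fin 2) :
    polyDer K s (MvPolynomial.X j) = ∑ i, s i j • MvPolynomial.X i :=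
  MvPolynomial.mkDerivation_X _ _ _

theorem polyDer_add (s t : Matrix (Fin 2) (Fin 2) K) :
    polyDer K (s + t) = polyDer K s + polyDer K t := by
  refine MvPolynomial.derivation_ext fun j => ?_
  rw [Derivation.add_apply]
  simp only [polyDer_X, Matrix.add_apply, add_smul, Finset.sum_add_distrib]

theorem polyDer_smul (c : K) (s : Matrix (Fin 2) (Fin 2) K) :
    polyDer K (c • s) = c • polyDer K s := by
  refine MvPolynomial.derivation_ext fun j => ?_
  rw [Derivation.smul_apply]
  simp only [polyDer_X, Matrix.smul_apply, smul_assoc, Finset.smul_sum]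

theorem polyDer_lie (s t : Matrix (Fin 2) (Fin 2) K) :
    polyDer K (s * t - t * s) = ⁅polyDer K s, polyDer K t⁆ := by
  refine MvPolynomial.derivation_ext fun j => ?_
  rw [Derivation.commutator_apply]
  have hs : ∀ (u : Matrix (Fin 2) (Fin 2) K) (c : K) (p : MvPolynomial (Fin 2) K),
      polyDer K u (c • p) = c • polyDer K u p := fun u c p => (polyDer K u).toLinearMap.map_smul c p
  simp only [polyDer_X, Fin.sum_univ_two, map_add, hs, Matrix.sub_apply,
    Matrix.mul_apply]
  module

theorem polyDer_eq (s : Matrix (Fin 2) (Fin 2) K) (p : MvPolynomial (Fin 2) K) :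
    polyDer K s p =
      ∑ j, (∑ i, s i j • MvPolynomial.X i : MvPolynomial (Fin 2) K) * MvPolynomial.pderiv j p := by
  have h : polyDer K s =
      ∑ j, (∑ i, s i j • MvPolynomial.X i : MvPolynomial (Fin 2) K) • MvPolynomial.pderiv j := by
    refine MvPolynomial.derivation_ext fun k => ?_
    rw [polyDer_X]
    fin_cases k <;> simp [Fin.sum_univ_two, MvPolynomial.pderiv_X]
  rw [h]
  simp [Fin.sum_univ_two]

theorem polyDer_mem (s : Matrix (Fin 2) (Fin 2) K) (n : ℕ) (p : MvPolynomial (Fin 2) K)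
    (hp : p ∈ MvPolynomial.homogeneousSubmodule (Fin 2) K n) :
    polyDer K s p ∈ MvPolynomial.homogeneousSubmodule (Fin 2) K n := by
  rw [MvPolynomial.mem_homogeneousSubmodule] at hp ⊢
  rw [polyDer_eq]
  refine MvPolynomial.IsHomogeneous.sum _ _ _ fun j _ => ?_
  rcases n with _ | n
  · have h : p = MvPolynomial.C (p.coeff 0) :=
      MvPolynomial.totalDegree_eq_zero_iff_eq_C.mp (Nat.le_zero.mp hp.totalDegree_le)
    rw [h, MvPolynomial.pderiv_C, mul_zero]
    exact MvPolynomial.isHomogeneous_zero _ _ _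
  · have h1 : (∑ i, s i j • MvPolynomial.X i : MvPolynomial (Fin 2) K).IsHomogeneous 1 := by
      refine MvPolynomial.IsHomogeneous.sum _ _ _ fun i _ => ?_
      rw [MvPolynomial.smul_eq_C_mul]
      exact MvPolynomial.isHomogeneous_C_mul_X _ _
    have h2 := h1.mul (hp.pderiv (i := j))
    rwa [Nat.add_sub_cancel, add_comm] at h2

variable (K) in
/-- The `𝔰𝔩₂`-module `L(n)`: the binary forms of degree `n`, i.e. the `n`-th symmetric power of
the standard two-dimensional module. It has dimension `n + 1` and, in characteristic zero, is the simple
`𝔰𝔩₂`-module of that dimension. -/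
def BinaryForm (n : ℕ) : Type u := ↥(MvPolynomial.homogeneousSubmodule (Fin 2) K n)

variable {n : ℕ}

instance : AddCommGroup (BinaryForm K n) :=
  inferInstanceAs (AddCommGroup ↥(MvPolynomial.homogeneousSubmodule (Fin 2) K n))

instance : Module K (BinaryForm K n) :=
  inferInstanceAs (Module K ↥(MvPolynomial.homogeneousSubmodule (Fin 2) K n))

instance : LieRingModule (sl2 K) (BinaryForm K n) where
  bracket s p := ⟨polyDer K s.1 p.1, polyDer_mem s.1 n p.1 p.2⟩
  add_lie s t p := Subtype.ext (DFunLike.congr_fun (polyDer_add s.1 t.1) p.1)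
  lie_add s p q := Subtype.ext (map_add (polyDer K s.1) p.1 q.1)
  leibniz_lie s t p := by
    apply Subtype.ext
    change polyDer K s.1 (polyDer K t.1 p.1) = polyDer K ⁅s, t⁆.1 p.1
      + polyDer K t.1 (polyDer K s.1 p.1)
    rw [LieAlgebra.SpecialLinear.sl_bracket, polyDer_lie, Derivation.commutator_apply,
      sub_add_cancel]

instance : LieModule K (sl2 K) (BinaryForm K n) where
  smul_lie c s p := Subtype.ext (DFunLike.congr_fun (polyDer_smul c s.1) p.1)
  lie_smul c s p := Subtype.ext ((polyDer K s.1).toLinearMap.map_smul c p.1)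

end Simple

/-- For a simple module `V` over a Lie algebra `L`, the isotypic component of type `V` of an
`L`-module `M`: the sum of all submodules of `M` isomorphic to `V`. -/
def lieIsotypicComponent (K : Type u) (L V M : Type*) [CommRing K] [LieRing L] [LieAlgebra K L]
    [AddCommGroup V] [Module K V] [LieRingModule L V]
    [AddCommGroup M] [Module K M] [LieRingModule L M] : LieSubmodule K L M :=
  sSup {N : LieSubmodule K L M | Nonempty (N ≃ₗ⁅K, L⁆ V)}

end

/-! Write L for the algebra 𝔰𝔩₂J and E for Λ²L / im Λ³L, so that H₂(L) is the kernel of the bracket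
map E → L. As an 𝔰𝔩₂-module L is a sum of trivial and adjoint modules, so by 𝔰𝔩₂ ⊗ 𝔰𝔩₂ = L(0) ⊕ L(2)
⊕ L(4) only these three types can occur in E. The proof shows that the bracket map loses nothing on
the first two.

Trivial part. For dual bases xᵢ, xⁱ of κ, the class of ∑ xᵢ(a) ∧ xⁱ(b) depends only on {a ∧ b}
(`mkQ_casWedge_self_sq`), and by `lieWedge_ofB_ofB` these classes also account for Λ²ℬJ. Their
bracket is 3{a ∧ b} (`toLie_casB`), so no nonzero one is a cycle.

Adjoint part. It is spanned by the classes `adWedge a b x`, because {a ∧ b} ∧ x(c) is expressed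
through them by `lieWedge_ofB_tm`. As a function of (a, b), `adWedge` is symmetric and satisfies the
cocycle form of the Jordan identity (`adWedge_swap`, `adWedge_jordan`), so it defines an extension
of J by a trivial module. Here freeness enters: over the free Jordan algebra the extension splits
(`FreeJordan.exists_linearMap_mul`), so `adWedge a b` depends only on ab. Its bracket is 2x(ab)
(`toLie_adWedge`), so again no nonzero class is a cycle.

What remains is spanned by the symmetric, trace-free combinations `quarticWedge`, all of which are
cycles. Hence their classes span H₂(L) (`mem_of_quarticClass_mem`). For fixed a, b they are the
image of a homomorphism from the binary quartics, which is either injective or zero; this gives the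
sum of copies of L(4). The Casimir element h² + 2ef + 2fe therefore acts by 24 on H₂(L). It acts by
0 on a trivial module and by 8 on the adjoint one, which excludes both without appeal to complete
reducibility. -/

/-! ### Extensions of the free Jordan algebra by trivial modules -/

section JordanExtension

variable {K : Type u} [Field K] {J : Type v} [NonUnitalNonAssocCommRing J] [Module K J]
  {W : Type*} [AddCommGroup W] [Module K W]

/-- The extension `J × W` of `J` by `W` with product `(a, v) (b, w) = (a b, f a b)`. -/
def JordanExt (_ : J →ₗ[K] J →ₗ[K] W) : Type _ := J × W

namespace JordanExt

variable (f : J →ₗ[K] J →ₗ[K] W)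

instance : AddCommGroup (JordanExt f) := inferInstanceAs (AddCommGroup (J × W))

instance : Module K (JordanExt f) := inferInstanceAs (Module K (J × W))

instance : Mul (JordanExt f) where
  mul p q := (p.1 * q.1, f p.1 q.1)

instance : NonUnitalNonAssocRing (JordanExt f) where
  __ := (inferInstance : AddCommGroup (JordanExt f))
  __ := (inferInstance : Mul (JordanExt f))
  left_distrib p q r := Prod.ext (mul_add p.1 q.1 r.1) (map_add (f p.1) q.1 r.1)
  right_distrib p q r :=
    Prod.ext (add_mul p.1 q.1 r.1) (LinearMap.congr_fun (map_add f p.1 q.1) r.1)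
  zero_mul p := Prod.ext (zero_mul p.1) (LinearMap.congr_fun (map_zero f) p.1)
  mul_zero p := Prod.ext (mul_zero p.1) (map_zero (f p.1))

instance [IsScalarTower K J J] : IsScalarTower K (JordanExt f) (JordanExt f) where
  smul_assoc c p q :=
    Prod.ext (smul_mul_assoc c p.1 q.1) (LinearMap.congr_fun (map_smul f c p.1) q.1)

instance [SMulCommClass K J J] : SMulCommClass K (JordanExt f) (JordanExt f) where
  smul_comm c p q := Prod.ext (mul_smul_comm c p.1 q.1).symm (map_smul (f p.1) c q.1).symm

end JordanExt

end JordanExtension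

namespace FreeJordan

variable {K : Type u} [Field K] {X : Type v} {W : Type*} [AddCommGroup W] [Module K W]

/-- The extensions of the free Jordan algebra by trivial modules split: a symmetric bilinear map
satisfying the cocycle form of the Jordan identity factors through the product. -/
theorem exists_linearMap_mul (f : FreeJordan K X →ₗ[K] FreeJordan K X →ₗ[K] W)
    (hc : ∀ a b, f a b = f b a) (hj : ∀ a b, f (a * a) (b * a) = f (a * a * b) a) :
    ∃ g : FreeJordan K X →ₗ[K] W, ∀ a b, f a b = g (a * b) := by
  -- The conditions `hc` and `hj` make the extension satisfy the Jordan relations, so the lift of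
  -- the generators to (x, 0) descends to the free Jordan algebra and splits the extension.
  let F : FreeNonUnitalNonAssocAlgebra K X →ₙₐ[K] JordanExt f :=
    FreeNonUnitalNonAssocAlgebra.lift K fun x => (show JordanExt f from (of K x, 0))
  have hrel : ∀ p q, Rel K X p q → F p = F q := by
    intro p q h
    induction h with
    | comm x y =>
      rw [map_mul, map_mul]
      exact Prod.ext (mul_comm _ _) (hc _ _)
    | jordan x y =>
      simp only [map_mul]
      refine Prod.ext ?_ (hj _ _)
      have h := IsCommJordan.lmul_comm_rmul_rmul (F x).1 (F y).1
      change (F x).1 * (F x).1 * ((F y).1 * (F x).1) = (F x).1 * (F x).1 * (F y).1 * (F x).1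
      simp only [mul_comm] at h ⊢
      exact h
    | smul t _ ih => rw [map_smul, map_smul, ih]
    | add_right c _ ih => rw [map_add, map_add, ih]
    | mul_left a _ ih => rw [map_mul, map_mul, ih]
    | mul_right c _ ih => rw [map_mul, map_mul, ih]
  let π : FreeNonUnitalNonAssocAlgebra K X →ₙₐ[K] FreeJordan K X :=
    { toFun := Quot.mk _
      map_smul' := fun _ _ => rfl
      map_zero' := rfl
      map_add' := fun _ _ => rfl
      map_mul' := fun _ _ => rfl }
  let ρ : JordanExt f →ₙₐ[K] FreeJordan K X :=
    { toFun := fun p => p.1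
      map_smul' := fun _ _ => rfl
      map_zero' := rfl
      map_add' := fun _ _ => rfl
      map_mul' := fun _ _ => rfl }
  -- The lift is a section: its first component is the quotient map, as can be checked on
  -- generators. Its second component will be `g`.
  have hfst : ρ.comp F = π := by
    refine FreeNonUnitalNonAssocAlgebra.hom_ext K fun x => ?_
    change (F (FreeNonUnitalNonAssocAlgebra.of K x)).1 = of K x
    rw [FreeNonUnitalNonAssocAlgebra.lift_of_apply]
  refine ⟨{ toFun := Quot.lift (fun p => (F p).2) fun p q h => by rw [hrel p q h]
            map_add' := ?_
            map_smul' := ?_ }, ?_⟩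
  · rintro ⟨p⟩ ⟨q⟩
    exact congrArg Prod.snd (map_add F p q)
  · rintro t ⟨p⟩
    exact congrArg Prod.snd (map_smul F t p)
  -- The second coordinate of the multiplicativity of `F` is exactly f(a, b) = g(ab).
  · rintro ⟨p⟩ ⟨q⟩
    have hp : (F p).1 = Quot.mk _ p := DFunLike.congr_fun hfst p
    have hq : (F q).1 = Quot.mk _ q := DFunLike.congr_fun hfst q
    have h : (F (p * q)).2 = f (F p).1 (F q).1 := congrArg Prod.snd (map_mul F p q)
    rw [hp, hq] at h
    exact h.symm

end FreeJordan

noncomputable section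

/-! ### The standard basis of `𝔰𝔩₂` -/

section SL2Basis

variable (K : Type u) [Field K]

/-- The element `e` of `𝔰𝔩₂`. -/
def sl2E : sl2 K := ⟨!![0, 1; 0, 0], by
  change Matrix.trace (_ : Matrix (Fin 2) (Fin 2) K) = 0; simp [Matrix.trace_fin_two]⟩

/-- The element `h` of `𝔰𝔩₂`. -/
def sl2H : sl2 K := ⟨!![1, 0; 0, -1], by
  change Matrix.trace (_ : Matrix (Fin 2) (Fin 2) K) = 0; simp [Matrix.trace_fin_two]⟩

/-- The element `f` of `𝔰𝔩₂`. -/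
def sl2F : sl2 K := ⟨!![0, 0; 1, 0], by
  change Matrix.trace (_ : Matrix (Fin 2) (Fin 2) K) = 0; simp [Matrix.trace_fin_two]⟩

variable {K}

theorem sl2_eq (x : sl2 K) : x = x.1 0 1 • sl2E K + x.1 0 0 • sl2H K + x.1 1 0 • sl2F K := by
  apply Subtype.ext
  change x.1 = x.1 0 1 • (sl2E K).1 + x.1 0 0 • (sl2H K).1 + x.1 1 0 • (sl2F K).1
  have h := sl2_entry x
  ext i j
  fin_cases i <;> fin_cases j <;> simp [sl2E, sl2H, sl2F, h]

theorem sl2_linearMap_ext {M : Type*} [AddCommGroup M] [Module K M] {g g' : sl2 K →ₗ[K] M}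
    (he : g (sl2E K) = g' (sl2E K)) (hh : g (sl2H K) = g' (sl2H K))
    (hf : g (sl2F K) = g' (sl2F K)) : g = g' := by
  refine LinearMap.ext fun x => ?_
  rw [sl2_eq x]
  simp only [map_add, map_smul, he, hh, hf]

theorem sl2_lie_HE : ⁅sl2H K, sl2E K⁆ = (2 : K) • sl2E K := by
  apply Subtype.ext
  change _ = (2 : K) • (sl2E K).1
  rw [LieAlgebra.SpecialLinear.sl_bracket]
  ext i j
  fin_cases i <;> fin_cases j <;> simp [sl2E, sl2H]
  norm_num

theorem sl2_lie_HF : ⁅sl2H K, sl2F K⁆ = (-2 : K) • sl2F K := by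
  apply Subtype.ext
  change _ = (-2 : K) • (sl2F K).1
  rw [LieAlgebra.SpecialLinear.sl_bracket]
  ext i j
  fin_cases i <;> fin_cases j <;> simp [sl2F, sl2H]
  norm_num

theorem sl2_lie_EF : ⁅sl2E K, sl2F K⁆ = sl2H K := by
  apply Subtype.ext
  rw [LieAlgebra.SpecialLinear.sl_bracket]
  ext i j
  fin_cases i <;> fin_cases j <;> simp [sl2F, sl2H, sl2E]

theorem sl2_lie_EH : ⁅sl2E K, sl2H K⁆ = (-2 : K) • sl2E K := by
  rw [← lie_skew, sl2_lie_HE, neg_smul]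

theorem sl2_lie_FH : ⁅sl2F K, sl2H K⁆ = (2 : K) • sl2F K := by
  rw [← lie_skew, sl2_lie_HF, neg_smul, neg_neg]

theorem sl2_lie_FE : ⁅sl2F K, sl2E K⁆ = -sl2H K := by
  rw [← lie_skew, sl2_lie_EF]

variable [CharZero K]

theorem kappa_EE : kappa K (sl2E K) (sl2E K) = 0 := by
  simp [kappa_eq, sl2E, Matrix.trace_fin_two]

theorem kappa_EH : kappa K (sl2E K) (sl2H K) = 0 := by
  simp [kappa_eq, sl2E, sl2H, Matrix.trace_fin_two]

theorem kappa_EF : kappa K (sl2E K) (sl2F K) = 2 := by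
  simp [kappa_eq, sl2E, sl2F, Matrix.trace_fin_two]

theorem kappa_HH : kappa K (sl2H K) (sl2H K) = 4 := by
  simp [kappa_eq, sl2H, Matrix.trace_fin_two]; norm_num

theorem kappa_HF : kappa K (sl2H K) (sl2F K) = 0 := by
  simp [kappa_eq, sl2F, sl2H, Matrix.trace_fin_two]

theorem kappa_FF : kappa K (sl2F K) (sl2F K) = 0 := by
  simp [kappa_eq, sl2F, Matrix.trace_fin_two]

theorem kappa_HE : kappa K (sl2H K) (sl2E K) = 0 := by rw [kappa_swap, kappa_EH]

theorem kappa_FE : kappa K (sl2F K) (sl2E K) = 2 := by rw [kappa_swap, kappa_EF]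

theorem kappa_FH : kappa K (sl2F K) (sl2H K) = 0 := by rw [kappa_swap, kappa_HF]

/-- The expansion of an element of `𝔰𝔩₂` in the dual bases `h, e, f` and `h / 4, f / 2, e / 2`
of `κ`. -/
theorem sl2_kappa_expand (x : sl2 K) : (4⁻¹ * kappa K (sl2H K) x) • sl2H K
    + (2⁻¹ * kappa K (sl2F K) x) • sl2E K + (2⁻¹ * kappa K (sl2E K) x) • sl2F K = x := by
  have h : ∀ y, kappa K y x = x.1 0 1 * kappa K y (sl2E K) + x.1 0 0 * kappa K y (sl2H K)
      + x.1 1 0 * kappa K y (sl2F K) := fun y => by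
    conv_lhs => rw [sl2_eq x]
    simp only [map_add, map_smul, smul_eq_mul]
  conv_rhs => rw [sl2_eq x]
  simp only [h, kappa_HE, kappa_HH, kappa_HF, kappa_EE, kappa_EH, kappa_EF, kappa_FE, kappa_FH,
    kappa_FF]
  have h4 : (4 : K) ≠ 0 := by norm_num
  match_scalars <;> field_simp <;> ring

end SL2Basis

/-! ### The exterior square of a Lie algebra -/

section ExteriorSquare

variable (K : Type u) [Field K] (L : Type*) [LieRing L] [LieAlgebra K L]

/-- The exterior square `Λ² L / im (Λ³ L → Λ² L)` of a Lie algebra. -/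
abbrev LieExtSq : Type _ := Ext₂ K L ⧸ LinearMap.range (ceD₃ K L)

/-- The class of `x ∧ y` in the exterior square of a Lie algebra. -/
def lieWedge : L →ₗ[K] L →ₗ[K] LieExtSq K L := wedge.compr₂ (LinearMap.range (ceD₃ K L)).mkQ

/-- The map from the exterior square of `L` to `L` induced by the bracket. -/
def LieExtSq.toLie : LieExtSq K L →ₗ[K] L :=
  (LinearMap.range (ceD₃ K L)).liftQ (ceD₂ K L) (by
    rintro _ ⟨w, rfl⟩
    exact ceD₂_ceD₃ K L w)

variable {K L}

theorem mkQ_wedge (x y : L) :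
    (LinearMap.range (ceD₃ K L)).mkQ (wedge (K := K) x y) = lieWedge K L x y := rfl

theorem LieExtSq.toLie_mkQ (z : Ext₂ K L) :
    LieExtSq.toLie K L ((LinearMap.range (ceD₃ K L)).mkQ z) = ceD₂ K L z := rfl

theorem LieExtSq.toLie_lieWedge (x y : L) : LieExtSq.toLie K L (lieWedge K L x y) = ⁅x, y⁆ :=
  ceD₂_wedge K L x y

theorem lieWedge_swap (x y : L) : lieWedge K L y x = -lieWedge K L x y := by
  rw [← mkQ_wedge, ← mkQ_wedge, wedge_swap, map_neg]

/-- The boundary of x ∧ y ∧ z, solved for one of its terms. All later relations in the exterior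
square that come from Λ³ are drawn from this one. -/
theorem lieWedge_lie_left (x y z : L) :
    lieWedge K L ⁅x, y⁆ z = lieWedge K L x ⁅y, z⁆ - lieWedge K L y ⁅x, z⁆ := by
  have h : (LinearMap.range (ceD₃ K L)).mkQ
      (ceD₃ K L (exteriorPower.ιMulti K 3 ![x, y, z])) = 0 := by
    rw [Submodule.mkQ_apply, Submodule.Quotient.mk_eq_zero]
    exact ⟨_, rfl⟩
  rw [ceD₃_apply, map_add, map_sub, mkQ_wedge, mkQ_wedge, mkQ_wedge, lieWedge_swap y,
    lieWedge_swap x] at h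
  linear_combination (norm := abel) h

end ExteriorSquare

/-! ### The trivial and adjoint components of the exterior square of `TAG(J)` -/

section TAGExtSq

variable (K : Type u) [Field K] [CharZero K] (J : Type v) [NonUnitalNonAssocCommRing J] [Module K J]
  [SMulCommClass K J J] [IsScalarTower K J J] [IsCommJordan J]

/-- The element `x(a)` of `TAG(J)`, bilinear in `x` and `a`. -/
def TAG.tm : sl2 K →ₗ[K] J →ₗ[K] TAG K J :=
  (TensorProduct.mk K (sl2 K) J).compr₂ (TAG.ofT K J)

/-- The bilinear map `(a, b) ↦ ∑ xᵢ(a) ∧ xⁱ(b)`, for dual bases `xᵢ`, `xⁱ` of `𝔰𝔩₂`. -/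
def casWedge : J →ₗ[K] J →ₗ[K] Ext₂ K (TAG K J) :=
  (4⁻¹ : K) • wedge.compl₁₂ (TAG.tm K J (sl2H K)) (TAG.tm K J (sl2H K))
    + (2⁻¹ : K) • wedge.compl₁₂ (TAG.tm K J (sl2E K)) (TAG.tm K J (sl2F K))
    + (2⁻¹ : K) • wedge.compl₁₂ (TAG.tm K J (sl2F K)) (TAG.tm K J (sl2E K))

variable {K J}

theorem TAG.lie_tm_tm (x y : sl2 K) (a b : J) : ⁅TAG.tm K J x a, TAG.tm K J y b⁆ =
    TAG.tm K J ⁅x, y⁆ (a * b) + kappa K x y • TAG.ofB K J (curly K a b) := by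
  rw [← map_smul]; exact TAG.lie_TT x y a b

theorem TAG.lie_tm_ofB (x : sl2 K) (a : J) (w : BJ K J) :
    ⁅TAG.tm K J x a, TAG.ofB K J w⁆ = -TAG.tm K J x (bDer K J w a) := TAG.lie_TB w x a

theorem casWedge_apply (a b : J) : casWedge K J a b =
    (4⁻¹ : K) • wedge (TAG.tm K J (sl2H K) a) (TAG.tm K J (sl2H K) b)
    + (2⁻¹ : K) • wedge (TAG.tm K J (sl2E K) a) (TAG.tm K J (sl2F K) b)
    + (2⁻¹ : K) • wedge (TAG.tm K J (sl2F K) a) (TAG.tm K J (sl2E K) b) := rfl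

/-- For dual bases ∑ [xᵢ, xⁱ] = 0, and ∑ κ(xᵢ, xⁱ) = dim 𝔰𝔩₂ = 3. -/
theorem ceD₂_casWedge (a b : J) :
    ceD₂ K (TAG K J) (casWedge K J a b) = (3 : K) • TAG.ofB K J (curly K a b) := by
  simp only [casWedge_apply, map_add, map_smul, ceD₂_wedge, TAG.lie_tm_tm, lie_self, sl2_lie_EF,
    sl2_lie_FE, kappa_HH, kappa_EF, kappa_FE, map_zero, LinearMap.zero_apply, map_neg,
    LinearMap.neg_apply]
  module

/-- `3 {a ∧ b} = ∑ [xᵢ(a), xⁱ(b)]`. -/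
theorem casimir_ofB (a b : J) : (3 : K) • TAG.ofB K J (curly K a b) =
    (4⁻¹ : K) • ⁅TAG.tm K J (sl2H K) a, TAG.tm K J (sl2H K) b⁆
    + (2⁻¹ : K) • ⁅TAG.tm K J (sl2E K) a, TAG.tm K J (sl2F K) b⁆
    + (2⁻¹ : K) • ⁅TAG.tm K J (sl2F K) a, TAG.tm K J (sl2E K) b⁆ := by
  rw [← ceD₂_casWedge, casWedge_apply]
  simp only [map_add, map_smul, ceD₂_wedge]

theorem casWedge_swap (a b : J) : casWedge K J b a = -casWedge K J a b := by
  simp only [casWedge_apply]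
  rw [wedge_swap (TAG.tm K J (sl2H K) a), wedge_swap (TAG.tm K J (sl2E K) a),
    wedge_swap (TAG.tm K J (sl2F K) a)]
  module

theorem casWedge_self (a : J) : casWedge K J a a = 0 := by
  have h : (2 : K) • casWedge K J a a = 0 := by
    rw [two_smul]
    nth_rewrite 1 [casWedge_swap]
    exact neg_add_cancel _
  exact (smul_eq_zero.mp h).resolve_left two_ne_zero

theorem mkQ_casWedge (a b : J) :
    (LinearMap.range (ceD₃ K (TAG K J))).mkQ (casWedge K J a b) =
    (4⁻¹ : K) • lieWedge K _ (TAG.tm K J (sl2H K) a) (TAG.tm K J (sl2H K) b)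
    + (2⁻¹ : K) • lieWedge K _ (TAG.tm K J (sl2E K) a) (TAG.tm K J (sl2F K) b)
    + (2⁻¹ : K) • lieWedge K _ (TAG.tm K J (sl2F K) a) (TAG.tm K J (sl2E K) b) := by
  simp only [casWedge_apply, map_add, map_smul, mkQ_wedge]

/-- Take the boundary of e(a) ∧ f(a) ∧ h(a). Since {a ∧ a} = 0, its brackets have no ℬJ component,
and the boundary is -4 times the Casimir sum for (a, a²). This is what lets the sum descend from Λ²J
to ℬJ. -/
theorem mkQ_casWedge_self_sq (a : J) :
    (LinearMap.range (ceD₃ K (TAG K J))).mkQ (casWedge K J a (a * a)) = 0 := by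
  have h := lieWedge_lie_left (K := K) (TAG.tm K J (sl2E K) a) (TAG.tm K J (sl2F K) a)
    (TAG.tm K J (sl2H K) a)
  rw [mkQ_casWedge]
  simp only [TAG.lie_tm_tm, curly_self, map_zero, smul_zero, add_zero, sl2_lie_EF, sl2_lie_EH,
    sl2_lie_FH, map_smul, LinearMap.smul_apply] at h
  rw [lieWedge_swap (TAG.tm K J (sl2H K) a)] at h
  linear_combination (norm := module) (-4⁻¹ : K) • h

variable (K J) in
/-- The map `{a ∧ b} ↦ ∑ xᵢ(a) ∧ xⁱ(b)` from `ℬJ` to the exterior square of `TAG(J)`. -/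
def casB : BJ K J →ₗ[K] LieExtSq K (TAG K J) :=
  (relR K J).liftQ
    ((LinearMap.range (ceD₃ K (TAG K J))).mkQ ∘ₗ wedgeLift (casWedge K J) casWedge_self) (by
      rw [relR, Submodule.span_le]
      rintro _ ⟨a, rfl⟩
      rw [SetLike.mem_coe, LinearMap.mem_ker, LinearMap.comp_apply, wedgeLift_wedge,
        mkQ_casWedge_self_sq])

theorem casB_curly (a b : J) : casB K J (curly K a b) =
    (LinearMap.range (ceD₃ K (TAG K J))).mkQ (casWedge K J a b) :=
  congrArg (LinearMap.range (ceD₃ K (TAG K J))).mkQ (wedgeLift_wedge _ casWedge_self a b)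

/-- Consequence used later: the bracket map is injective on the trivial component. -/
theorem toLie_casB (w : BJ K J) :
    LieExtSq.toLie K (TAG K J) (casB K J w) = (3 : K) • TAG.ofB K J w := by
  induction w using BJ_induction with
  | hc a b => rw [casB_curly, LieExtSq.toLie_mkQ, ceD₂_casWedge]
  | ha w w' h h' => simp only [map_add, h, h', smul_add]
  | hs c w h => simp only [map_smul, h, smul_comm c]

/-- `3 ω ∧ ω' = -∑ xᵢ(a) ∧ xⁱ(∂ ω' b) + xᵢ(∂ ω' a) ∧ xⁱ(b)` for `ω = {a ∧ b}`. -/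
theorem lieWedge_ofB_ofB (w w' : BJ K J) :
    (3 : K) • lieWedge K _ (TAG.ofB K J w) (TAG.ofB K J w') = -casB K J (bAct K J w' w) := by
  induction w using BJ_induction with
  | hc a b =>
    -- Replacing 3{a ∧ b} by a sum of brackets lets the boundary relation move ω' inside, where it
    -- acts through ∂.
    rw [← LinearMap.smul_apply, ← map_smul, casimir_ofB, bAct_curly]
    simp only [map_add, map_smul, LinearMap.add_apply, LinearMap.smul_apply, lieWedge_lie_left,
      TAG.lie_tm_ofB, casB_curly, mkQ_casWedge, map_neg]
    rw [lieWedge_swap _ (TAG.tm K J (sl2H K) b), lieWedge_swap _ (TAG.tm K J (sl2E K) b),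
      lieWedge_swap _ (TAG.tm K J (sl2F K) b)]
    module
  | ha x y hx hy => simp only [map_add, LinearMap.add_apply, smul_add, hx, hy, neg_add]
  | hs c x hx => simp only [map_smul, LinearMap.smul_apply, smul_comm (3 : K) c, hx, smul_neg]

/-! ### The adjoint component and its Jordan cocycle identity. -/

variable (K J) in
/-- The map `(a, b) ↦ (x ↦ ∑ xᵢ(a) ∧ [xⁱ, x](b))`. -/
def adWedge : J →ₗ[K] J →ₗ[K] sl2 K →ₗ[K] LieExtSq K (TAG K J) :=
  LinearMap.mk₂ K (fun a b =>
    (4⁻¹ : K) • lieWedge K _ (TAG.tm K J (sl2H K) a) ∘ₗ (TAG.tm K J).flip b ∘ₗ sl2Lie K (sl2H K)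
    + (2⁻¹ : K) • lieWedge K _ (TAG.tm K J (sl2E K) a) ∘ₗ (TAG.tm K J).flip b ∘ₗ sl2Lie K (sl2F K)
    + (2⁻¹ : K) • lieWedge K _ (TAG.tm K J (sl2F K) a) ∘ₗ (TAG.tm K J).flip b ∘ₗ sl2Lie K (sl2E K))
    (by intros; simp only [map_add, LinearMap.add_comp]; module)
    (by intros; simp only [map_smul, LinearMap.smul_comp]; module)
    (by intros; simp only [map_add, LinearMap.add_comp, LinearMap.comp_add]; module)
    (by intros; simp only [map_smul, LinearMap.smul_comp, LinearMap.comp_smul]; module)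

theorem adWedge_apply (a b : J) (x : sl2 K) : adWedge K J a b x =
    (4⁻¹ : K) • lieWedge K _ (TAG.tm K J (sl2H K) a) (TAG.tm K J ⁅sl2H K, x⁆ b)
    + (2⁻¹ : K) • lieWedge K _ (TAG.tm K J (sl2E K) a) (TAG.tm K J ⁅sl2F K, x⁆ b)
    + (2⁻¹ : K) • lieWedge K _ (TAG.tm K J (sl2F K) a) (TAG.tm K J ⁅sl2E K, x⁆ b) := rfl

/-- Invariance of the Casimir tensor gives ∑ xᵢ ⊗ [xⁱ, x] = -∑ [xᵢ, x] ⊗ xⁱ; this sign cancels the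
one from the antisymmetry of ∧. -/
theorem adWedge_swap (a b : J) : adWedge K J a b = adWedge K J b a := by
  refine sl2_linearMap_ext ?_ ?_ ?_
  · simp only [adWedge_apply, sl2_lie_FE, sl2_lie_HE, lie_self, map_smul, map_neg, map_zero,
      LinearMap.neg_apply, LinearMap.smul_apply, LinearMap.zero_apply]
    rw [lieWedge_swap (TAG.tm K J (sl2H K) a) (TAG.tm K J (sl2E K) b),
      lieWedge_swap (TAG.tm K J (sl2E K) a) (TAG.tm K J (sl2H K) b)]
    module
  · simp only [adWedge_apply, lie_self, sl2_lie_EH, sl2_lie_FH, map_smul, map_zero,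
      LinearMap.smul_apply, LinearMap.zero_apply]
    rw [lieWedge_swap (TAG.tm K J (sl2E K) a) (TAG.tm K J (sl2F K) b),
      lieWedge_swap (TAG.tm K J (sl2F K) a) (TAG.tm K J (sl2E K) b)]
    module
  · simp only [adWedge_apply, lie_self, sl2_lie_EF, sl2_lie_HF, map_smul, map_zero,
      LinearMap.smul_apply, LinearMap.zero_apply]
    rw [lieWedge_swap (TAG.tm K J (sl2H K) a) (TAG.tm K J (sl2F K) b),
      lieWedge_swap (TAG.tm K J (sl2F K) a) (TAG.tm K J (sl2H K) b)]
    module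

/-- The antisymmetric part of `x(a) ∧ y(b)` is determined by `[x, y]`. -/
theorem adWedge_lie (a b : J) (x y : sl2 K) : adWedge K J a b ⁅x, y⁆ =
    lieWedge K _ (TAG.tm K J x a) (TAG.tm K J y b)
      - lieWedge K _ (TAG.tm K J y a) (TAG.tm K J x b) := by
  -- Since [xⁱ, [x, y]] = κ(xⁱ, x) y - κ(xⁱ, y) x, the sum contracts by x = ∑ κ(xⁱ, x) xᵢ and the
  -- same formula for y.
  simp only [adWedge_apply, sl2_double_lie', map_sub, LinearMap.sub_apply, map_smul,
    LinearMap.smul_apply]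
  have hx := congrArg (fun t => lieWedge K _ (TAG.tm K J t a) (TAG.tm K J y b)) (sl2_kappa_expand x)
  have hy := congrArg (fun t => lieWedge K _ (TAG.tm K J t a) (TAG.tm K J x b)) (sl2_kappa_expand y)
  simp only [map_add, map_smul, LinearMap.add_apply, LinearMap.smul_apply] at hx hy
  linear_combination (norm := module) hx - hy

/-- ∑ [xᵢ, [xⁱ, x]] = 3x - x = 2x, the Casimir eigenvalue on the adjoint module for κ. The ℬJ
component has coefficient ∑ κ(xᵢ, [xⁱ, x]) = 0. -/
theorem toLie_adWedge (a b : J) (x : sl2 K) :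
    LieExtSq.toLie K _ (adWedge K J a b x) = (2 : K) • TAG.tm K J x (a * b) := by
  revert x
  refine LinearMap.congr_fun (f := LieExtSq.toLie K (TAG K J) ∘ₗ adWedge K J a b)
    (g := (2 : K) • (TAG.tm K J).flip (a * b)) (sl2_linearMap_ext ?_ ?_ ?_) <;>
  · simp only [LinearMap.comp_apply, LinearMap.smul_apply, LinearMap.flip_apply,
      adWedge_apply, lie_self, sl2_lie_EF, sl2_lie_FE, sl2_lie_HE, sl2_lie_EH, sl2_lie_HF,
      sl2_lie_FH, map_smul, map_neg, map_zero, LinearMap.neg_apply, LinearMap.smul_apply,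
      LinearMap.zero_apply, map_add, LieExtSq.toLie_lieWedge, TAG.lie_tm_tm, kappa_HE,
      kappa_HF, kappa_EH, kappa_EF, kappa_FE, kappa_FH, neg_smul]
    module

/-- `3 {a ∧ b} ∧ x(c) = ∑ xᵢ(a) ∧ [xⁱ(b), x(c)] - xᵢ(b) ∧ [xⁱ(a), x(c)]`. -/
theorem lieWedge_ofB_tm_aux (a b c : J) (x : sl2 K) :
    (3 : K) • lieWedge K _ (TAG.ofB K J (curly K a b)) (TAG.tm K J x c) =
    adWedge K J a (b * c) x - adWedge K J b (a * c) x
      - lieWedge K _ (TAG.ofB K J (curly K b c)) (TAG.tm K J x a)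
      - lieWedge K _ (TAG.ofB K J (curly K c a)) (TAG.tm K J x b) := by
  -- The ℬJ component of [xⁱ(b), x(c)] is κ(xⁱ, x){b ∧ c}; summing against xᵢ(a) leaves x(a) ∧ {b ∧
  -- c}. The other half of the sum is treated by `hb`.
  have ha := congrArg (fun t => lieWedge K _ (TAG.tm K J t a) (TAG.ofB K J (curly K b c)))
    (sl2_kappa_expand x)
  have hb := congrArg (fun t => lieWedge K _ (TAG.tm K J t b) (TAG.ofB K J (curly K a c)))
    (sl2_kappa_expand x)
  rw [← LinearMap.smul_apply, ← map_smul, casimir_ofB,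
    lieWedge_swap (TAG.tm K J x a) (TAG.ofB K J _), lieWedge_swap (TAG.tm K J x b) (TAG.ofB K J _),
    curly_swap a c]
  simp only [map_add, map_smul, map_neg, LinearMap.add_apply, LinearMap.smul_apply,
    lieWedge_lie_left] at ha hb ⊢
  simp only [TAG.lie_tm_tm, adWedge_apply, map_add, map_smul]
  linear_combination (norm := module) ha - hb

/-- Let T be the cyclic sum of {a ∧ b} ∧ x(c). Adding the three cyclic forms of the auxiliary
identity, the `adWedge` terms cancel in pairs and 3T = -2T, so 5T = 0 and T = 0. Hence the two
remaining terms of the auxiliary identity can be absorbed into the left side. -/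
theorem lieWedge_ofB_tm (a b c : J) (x : sl2 K) :
    (2 : K) • lieWedge K _ (TAG.ofB K J (curly K a b)) (TAG.tm K J x c) =
    adWedge K J a (b * c) x - adWedge K J b (a * c) x := by
  have h1 := lieWedge_ofB_tm_aux (K := K) a b c x
  have h2 := lieWedge_ofB_tm_aux (K := K) b c a x
  have h3 := lieWedge_ofB_tm_aux (K := K) c a b x
  rw [mul_comm c a, mul_comm b a] at h2
  rw [mul_comm c b] at h3
  linear_combination (norm := module) h1 - (5⁻¹ : K) • (h1 + h2 + h3)

/-- Since {a² ∧ a} = 0 in ℬJ, the previous lemma for (a², a, b) has zero left side, and what remains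
is the Jordan cocycle condition. With `adWedge_swap` it supplies the hypotheses of
`FreeJordan.exists_linearMap_mul`. -/
theorem adWedge_jordan (a b : J) :
    adWedge K J (a * a) (b * a) = adWedge K J (a * a * b) a := by
  refine LinearMap.ext fun x => ?_
  have h := lieWedge_ofB_tm (K := K) (a * a) a b x
  rw [curly_swap a, curly_self_sq, neg_zero, map_zero, map_zero, LinearMap.zero_apply, smul_zero,
    mul_comm a b, adWedge_swap a] at h
  exact sub_eq_zero.mp h.symm

end TAGExtSq

end

noncomputable section

/-! ### Quartic forms in an `𝔰𝔩₂`-module -/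

section Quartic

variable {K : Type u} [Field K]

theorem sl2_lie_E (s : sl2 K) :
    ⁅s, sl2E K⁆ = (2 * s.1 0 0) • sl2E K - s.1 1 0 • sl2H K := by
  conv_lhs => rw [sl2_eq s]
  simp only [add_lie, smul_lie, lie_self, sl2_lie_HE, sl2_lie_FE]
  module

theorem sl2_lie_H (s : sl2 K) :
    ⁅s, sl2H K⁆ = (2 * s.1 1 0) • sl2F K - (2 * s.1 0 1) • sl2E K := by
  conv_lhs => rw [sl2_eq s]
  simp only [add_lie, smul_lie, lie_self, sl2_lie_EH, sl2_lie_FH]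
  module

theorem sl2_lie_F (s : sl2 K) :
    ⁅s, sl2F K⁆ = s.1 0 1 • sl2H K - (2 * s.1 0 0) • sl2F K := by
  conv_lhs => rw [sl2_eq s]
  simp only [add_lie, smul_lie, lie_self, sl2_lie_EF, sl2_lie_HF]
  module

/-! ### Binary forms in the monomial basis. -/

/-- The exponent of the monomial `X₀ⁱ X₁ⁿ⁻ⁱ`. -/
def binaryExp (n i : ℕ) : Fin 2 →₀ ℕ := Finsupp.single 0 i + Finsupp.single 1 (n - i)

theorem binaryExp_zero (n i : ℕ) : binaryExp n i 0 = i := by simp [binaryExp]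

theorem binaryExp_one (n i : ℕ) : binaryExp n i 1 = n - i := by simp [binaryExp]

theorem eq_binaryExp {n : ℕ} {d : Fin 2 →₀ ℕ} (h : d 0 + d 1 = n) : d = binaryExp n (d 0) := by
  ext j
  fin_cases j
  · exact (binaryExp_zero n _).symm
  · change d 1 = binaryExp n (d 0) 1
    rw [binaryExp_one]; omega

theorem binaryForm_eq_sum {n : ℕ} {p : MvPolynomial (Fin 2) K} (hp : p.IsHomogeneous n) :
    p = ∑ i ∈ Finset.range (n + 1),
      MvPolynomial.monomial (binaryExp n i) (p.coeff (binaryExp n i)) := by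
  ext d
  rw [MvPolynomial.coeff_sum]
  simp only [MvPolynomial.coeff_monomial]
  by_cases h : d 0 + d 1 = n
  · rw [Finset.sum_eq_single (d 0)]
    · rw [← eq_binaryExp h, if_pos rfl]
    · intro i _ hi
      rw [if_neg]
      rintro rfl
      exact hi (binaryExp_zero n i).symm
    · intro h'
      exact absurd (Finset.mem_range.mpr (by omega)) h'
  · rw [Finset.sum_eq_zero, ← not_ne_iff]
    · intro h'
      apply h
      have := hp h'
      simpa [Finsupp.weight_apply, Finsupp.sum_fintype] using this
    · intro i hi
      rw [if_neg]
      rintro rfl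
      rw [binaryExp_zero, binaryExp_one] at h
      have := Finset.mem_range.mp hi
      omega

/-- A traceless s acts as s₀₀(X₀∂₀ - X₁∂₁) + s₁₀X₁∂₀ + s₀₁X₀∂₁. At the ends i = 0 and i = n the
indices i - 1 and i + 1 are meaningless, but their coefficients vanish. -/
theorem polyDer_monomial (s : sl2 K) {n i : ℕ} (hi : i ≤ n) (c : K) :
    polyDer K s.1 (MvPolynomial.monomial (binaryExp n i) c) =
      MvPolynomial.monomial (binaryExp n i) (s.1 0 0 * (i - (n - i : ℕ)) * c)
      + MvPolynomial.monomial (binaryExp n (i - 1)) (s.1 1 0 * i * c)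
      + MvPolynomial.monomial (binaryExp n (i + 1)) (s.1 0 1 * (n - i : ℕ) * c) := by
  have hX : ∀ (a b : K) (j : Fin 2) (d : Fin 2 →₀ ℕ), (a • MvPolynomial.X j :
      MvPolynomial (Fin 2) K) * MvPolynomial.monomial d b =
      MvPolynomial.monomial (Finsupp.single j 1 + d) (a * b) := fun a b j d => by
    rw [MvPolynomial.X, MvPolynomial.smul_monomial, MvPolynomial.monomial_mul, smul_eq_mul, mul_one]
  have e1 : i ≠ 0 → Finsupp.single 0 1 + (binaryExp n i - Finsupp.single 0 1) = binaryExp n i := by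
    intro h; ext j; fin_cases j <;> simp [binaryExp]; omega
  have e2 : i ≠ 0 → Finsupp.single 1 1 + (binaryExp n i - Finsupp.single 0 1) =
      binaryExp n (i - 1) := by
    intro h; ext j; fin_cases j <;> simp [binaryExp]; omega
  have e3 : n - i ≠ 0 → Finsupp.single 0 1 + (binaryExp n i - Finsupp.single 1 1) =
      binaryExp n (i + 1) := by
    intro h; ext j; fin_cases j <;> simp [binaryExp] <;> omega
  have e4 : n - i ≠ 0 → Finsupp.single 1 1 + (binaryExp n i - Finsupp.single 1 1) =
      binaryExp n i := by
    intro h; ext j; fin_cases j <;> simp [binaryExp]; omega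
  have hs := sl2_entry s
  rw [polyDer_eq]
  simp only [Fin.sum_univ_two, MvPolynomial.pderiv_monomial, add_mul, hX, binaryExp_zero,
    binaryExp_one]
  -- The exponents after differentiation are the expected ones only where the derivative is nonzero;
  -- otherwise both monomials are zero. `k0` and `k1` cover the two variables.
  have k0 : ∀ (d d' : Fin 2 →₀ ℕ) (a : K), (i ≠ 0 → d = d') →
      MvPolynomial.monomial d (a * (c * i)) = MvPolynomial.monomial d' (a * (c * i)) := by
    intro d d' a h
    rcases eq_or_ne i 0 with rfl | hi
    · simp
    · rw [h hi]
  have k1 : ∀ (d d' : Fin 2 →₀ ℕ) (a : K), (n - i ≠ 0 → d = d') →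
      MvPolynomial.monomial d (a * (c * (n - i : ℕ))) =
        MvPolynomial.monomial d' (a * (c * (n - i : ℕ))) := by
    intro d d' a h
    rcases eq_or_ne (n - i) 0 with h0 | hi
    · simp [h0]
    · rw [h hi]
  rw [k0 _ _ _ e1, k0 _ _ _ e2, k1 _ _ _ e3, k1 _ _ _ e4, hs]
  have r1 : s.1 0 0 * (i - (n - i : ℕ)) * c = s.1 0 0 * (c * i) + -s.1 0 0 * (c * (n - i : ℕ)) := by
    ring
  have r2 : s.1 1 0 * i * c = s.1 1 0 * (c * i) := by ring
  have r3 : s.1 0 1 * (n - i : ℕ) * c = s.1 0 1 * (c * (n - i : ℕ)) := by ring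
  rw [r1, r2, r3, map_add]
  abel

/-! ### Invariant bilinear maps on 𝔰𝔩₂ of type L(4). -/

variable {M : Type*} [AddCommGroup M] [Module K M] [LieRingModule (sl2 K) M]
  [LieModule K (sl2 K) M]

/-- The vectors attached to a bilinear map `β` on `𝔰𝔩₂`, in such a way that `X₀ⁱ X₁⁴⁻ⁱ`
corresponds to `quarticVec β i` if `x ↦ β x x` corresponds to the square of the identification of
`𝔰𝔩₂` with the quadratic forms. -/
def quarticVec (β : sl2 K →ₗ[K] sl2 K →ₗ[K] M) : ℕ → M
  -- The identification is e ↦ X₀², h ↦ -2X₀X₁, f ↦ -X₁²; for instance ef ↦ -X₀²X₁².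
  | 0 => β (sl2F K) (sl2F K)
  | 1 => (2⁻¹ : K) • β (sl2H K) (sl2F K)
  | 2 => -β (sl2E K) (sl2F K)
  | 3 => (-2⁻¹ : K) • β (sl2E K) (sl2H K)
  | 4 => β (sl2E K) (sl2E K)
  | _ => 0

/-- An invariant symmetric bilinear map on `𝔰𝔩₂` which vanishes on the Casimir tensor. -/
structure IsQuartic (β : sl2 K →ₗ[K] sl2 K →ₗ[K] M) : Prop where
  swap : ∀ x y, β x y = β y x
  lie : ∀ s x y : sl2 K, ⁅s, β x y⁆ = β ⁅s, x⁆ y + β x ⁅s, y⁆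
  -- The Casimir tensor is ¼ h⊗h + ½ e⊗f + ½ f⊗e; by symmetry its last two terms give equal values.
  casimir : β (sl2H K) (sl2H K) = (-4 : K) • β (sl2E K) (sl2F K)

namespace IsQuartic

variable [CharZero K] {β : sl2 K →ₗ[K] sl2 K →ₗ[K] M}

/-- The same formula as `polyDer_monomial` for n = 4, which makes `IsQuartic.hom` equivariant. The
case i = 2 needs the Casimir condition, since h and e·f produce both β(h, h) and β(e, f). -/
theorem lie_quarticVec (hβ : IsQuartic β) (s : sl2 K) {i : ℕ} (hi : i ≤ 4) :
    ⁅s, quarticVec β i⁆ =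
      (s.1 0 0 * (i - (4 - i : ℕ))) • quarticVec β i + (s.1 1 0 * i) • quarticVec β (i - 1)
      + (s.1 0 1 * (4 - i : ℕ)) • quarticVec β (i + 1) := by
  have h2 := hβ.swap (sl2F K) (sl2H K)
  have h3 := hβ.swap (sl2H K) (sl2E K)
  have h4 := hβ.casimir
  interval_cases i <;>
  · simp only [quarticVec, lie_smul, lie_neg, hβ.lie, sl2_lie_E, sl2_lie_H, sl2_lie_F, map_sub,
      map_smul, LinearMap.sub_apply, LinearMap.smul_apply, h2, h3, h4]
    module

/-- Symmetry leaves six values on the basis e, h, f, and the Casimir condition removes β(h, h); the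
other five are nonzero multiples of the vectors `quarticVec β i`. -/
theorem mem_of_quarticVec_mem (hβ : IsQuartic β) (N : Submodule K M) (hN : ∀ i ≤ 4, quarticVec β i ∈ N)
    (x y : sl2 K) : β x y ∈ N := by
  have hFF : β (sl2F K) (sl2F K) ∈ N := hN 0 (by norm_num)
  have hHF : β (sl2H K) (sl2F K) ∈ N :=
    (N.smul_mem_iff (inv_ne_zero two_ne_zero)).mp (hN 1 (by norm_num))
  have hEF : β (sl2E K) (sl2F K) ∈ N := neg_mem_iff.mp (hN 2 (by norm_num))
  have hEH : β (sl2E K) (sl2H K) ∈ N :=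
    (N.smul_mem_iff (neg_ne_zero.mpr (inv_ne_zero two_ne_zero))).mp (hN 3 (by norm_num))
  have hEE : β (sl2E K) (sl2E K) ∈ N := hN 4 (by norm_num)
  have hHH : β (sl2H K) (sl2H K) ∈ N := by rw [hβ.casimir]; exact N.smul_mem _ hEF
  have hHE : β (sl2H K) (sl2E K) ∈ N := by rwa [hβ.swap]
  have hFE : β (sl2F K) (sl2E K) ∈ N := by rwa [hβ.swap]
  have hFH : β (sl2F K) (sl2H K) ∈ N := by rwa [hβ.swap]
  rw [sl2_eq x, sl2_eq y]
  simp only [map_add, map_smul, LinearMap.add_apply, LinearMap.smul_apply]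
  refine add_mem (add_mem ?_ ?_) ?_ <;> refine N.smul_mem _ (add_mem (add_mem ?_ ?_) ?_) <;>
    exact N.smul_mem _ ‹_›

/-- The Casimir element `h² + 2 e f + 2 f e` acts by `24`. -/
theorem casimir_act (hβ : IsQuartic β) (x y : sl2 K) :
    ⁅sl2H K, ⁅sl2H K, β x y⁆⁆ + (2 : K) • ⁅sl2E K, ⁅sl2F K, β x y⁆⁆
      + (2 : K) • ⁅sl2F K, ⁅sl2E K, β x y⁆⁆ = (24 : K) • β x y := by
  -- The constant 24 is n(n + 2) for highest weight n = 4. The kernel of C is a subspace, so it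
  -- suffices to test the five weight vectors.
  let φ : sl2 K → Module.End K M := LieModule.toEnd K (sl2 K) M
  let C : Module.End K M := φ (sl2H K) * φ (sl2H K) + (2 : K) • (φ (sl2E K) * φ (sl2F K))
    + (2 : K) • (φ (sl2F K) * φ (sl2E K)) - (24 : K) • 1
  have hC : ∀ m, C m = ⁅sl2H K, ⁅sl2H K, m⁆⁆ + (2 : K) • ⁅sl2E K, ⁅sl2F K, m⁆⁆
      + (2 : K) • ⁅sl2F K, ⁅sl2E K, m⁆⁆ - (24 : K) • m := fun m => rfl
  have hE : ∀ i ≤ 4, ⁅sl2E K, quarticVec β i⁆ = ((4 - i : ℕ) : K) • quarticVec β (i + 1) :=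
    fun i hi => by simp [hβ.lie_quarticVec _ hi, sl2E]
  have hF : ∀ i ≤ 4, ⁅sl2F K, quarticVec β i⁆ = (i : K) • quarticVec β (i - 1) :=
    fun i hi => by simp [hβ.lie_quarticVec _ hi, sl2F]
  have hH : ∀ i ≤ 4, ⁅sl2H K, quarticVec β i⁆ = (i - (4 - i : ℕ) : K) • quarticVec β i :=
    fun i hi => by simp [hβ.lie_quarticVec _ hi, sl2H]
  refine sub_eq_zero.mp ((hC _).symm.trans (LinearMap.mem_ker.mp ?_))
  refine hβ.mem_of_quarticVec_mem (LinearMap.ker C) (fun i hi => ?_) x y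
  rw [LinearMap.mem_ker, hC, hH i hi, hE i hi, hF i hi, lie_smul, lie_smul, lie_smul, hH i hi]
  interval_cases i
  · rw [hF 1 (by norm_num)]; norm_num; module
  · rw [hE 0 (by norm_num), hF 2 (by norm_num)]; norm_num; module
  · rw [hE 1 (by norm_num), hF 3 (by norm_num)]; norm_num; module
  · rw [hE 2 (by norm_num), hF 4 (by norm_num)]; norm_num; module
  · rw [hE 3 (by norm_num)]; norm_num; module

end IsQuartic

/-- The linear map from polynomials in two variables with `X₀ⁱ X₁ʲ ↦ v i`. -/
def monomialLift (v : ℕ → M) : MvPolynomial (Fin 2) K →ₗ[K] M :=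
  (MvPolynomial.basisMonomials (Fin 2) K).constr K fun d => v (d 0)

theorem monomialLift_monomial (v : ℕ → M) (d : Fin 2 →₀ ℕ) (c : K) :
    monomialLift v (MvPolynomial.monomial d c) = c • v (d 0) := by
  have h : MvPolynomial.monomial d c = c • MvPolynomial.basisMonomials (Fin 2) K d := by
    rw [MvPolynomial.coe_basisMonomials, MvPolynomial.smul_monomial, smul_eq_mul, mul_one]
  rw [h, map_smul, monomialLift, Module.Basis.constr_basis]

/-- The homomorphism from the quartic forms attached to an invariant bilinear map. -/
def IsQuartic.hom [CharZero K] {β : sl2 K →ₗ[K] sl2 K →ₗ[K] M} (hβ : IsQuartic β) :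
    BinaryForm K 4 →ₗ⁅K, sl2 K⁆ M where
  toFun p := monomialLift (quarticVec β) p.1
  map_add' p q := map_add (monomialLift (quarticVec β)) p.1 q.1
  map_smul' c p := map_smul (monomialLift (quarticVec β)) c p.1
  map_lie' {s p} := by
    change monomialLift (quarticVec β) (polyDer K s.1 p.1) = ⁅s, monomialLift (quarticVec β) p.1⁆
    rw [binaryForm_eq_sum p.2]
    simp only [map_sum, lie_sum]
    refine Finset.sum_congr rfl fun i hi => ?_
    have hi' : i ≤ 4 := Nat.lt_succ_iff.mp (Finset.mem_range.mp hi)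
    rw [polyDer_monomial s hi']
    simp only [map_add, monomialLift_monomial, binaryExp_zero, lie_smul, hβ.lie_quarticVec s hi']
    module

theorem IsQuartic.hom_apply [CharZero K] {β : sl2 K →ₗ[K] sl2 K →ₗ[K] M} (hβ : IsQuartic β)
    (p : BinaryForm K 4) : hβ.hom p =
      ∑ i ∈ Finset.range 5, p.1.coeff (binaryExp 4 i) • quarticVec β i := by
  change monomialLift (quarticVec β) p.1 = _
  conv_lhs => rw [binaryForm_eq_sum p.2]
  simp only [map_sum, monomialLift_monomial, binaryExp_zero]

theorem IsQuartic.quarticVec_mem_range [CharZero K] {β : sl2 K →ₗ[K] sl2 K →ₗ[K] M}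
    (hβ : IsQuartic β) {i : ℕ} (hi : i ≤ 4) : quarticVec β i ∈ hβ.hom.range := by
  refine ⟨⟨MvPolynomial.monomial (binaryExp 4 i) 1, ?_⟩, ?_⟩
  · refine MvPolynomial.isHomogeneous_monomial 1 ?_
    simp [Finsupp.degree_eq_sum, binaryExp]
    omega
  · change monomialLift (quarticVec β) (MvPolynomial.monomial (binaryExp 4 i) 1) = _
    rw [monomialLift_monomial, binaryExp_zero, one_smul]

/-- The raising operator e sends vector i to 4 - i times vector i + 1. Applied repeatedly to a
linear relation it gives a triangular system: e⁴ isolates c₀, then e³ isolates c₁, and so on, each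
time against a nonzero multiple of the top vector. -/
theorem IsQuartic.hom_injective [CharZero K] {β : sl2 K →ₗ[K] sl2 K →ₗ[K] M}
    (hβ : IsQuartic β) (h : quarticVec β 4 ≠ 0) : Function.Injective hβ.hom := by
  have hE : ∀ i ≤ 4, ⁅sl2E K, quarticVec β i⁆ = ((4 - i : ℕ) : K) • quarticVec β (i + 1) :=
    fun i hi => by simp [hβ.lie_quarticVec _ hi, sl2E]
  have e0 := hE 0 (by norm_num)
  have e1 := hE 1 (by norm_num)
  have e2 := hE 2 (by norm_num)
  have e3 := hE 3 (by norm_num)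
  have e4 := hE 4 (by norm_num)
  have key : ∀ c : ℕ → K, ∑ i ∈ Finset.range 5, c i • quarticVec β i = 0 → ∀ i < 5, c i = 0 := by
    intro c h0
    simp only [Finset.sum_range_succ, Finset.sum_range_zero, zero_add] at h0
    have h1 := congrArg (fun m => ⁅sl2E K, m⁆) h0
    simp only [lie_add, lie_smul, e0, e1, e2, e3, e4, lie_zero] at h1
    have h2 := congrArg (fun m => ⁅sl2E K, m⁆) h1
    simp only [lie_add, lie_smul, e1, e2, e3, e4, lie_zero] at h2
    have h3 := congrArg (fun m => ⁅sl2E K, m⁆) h2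
    simp only [lie_add, lie_smul, e2, e3, e4, lie_zero] at h3
    have h4 := congrArg (fun m => ⁅sl2E K, m⁆) h3
    simp only [lie_add, lie_smul, e3, e4, lie_zero] at h4
    have c0 : c 0 = 0 := by simpa [h] using h4
    have c1 : c 1 = 0 := by simpa [h, c0] using h3
    have c2 : c 2 = 0 := by simpa [h, c0, c1] using h2
    have c3 : c 3 = 0 := by simpa [h, c0, c1, c2] using h1
    have c4 : c 4 = 0 := by simpa [h, c0, c1, c2, c3] using h0
    intro i hi
    interval_cases i <;> assumption
  refine (injective_iff_map_eq_zero hβ.hom).mpr fun p hp => Subtype.ext ?_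
  rw [hβ.hom_apply] at hp
  rw [binaryForm_eq_sum p.2]
  refine Finset.sum_eq_zero fun i hi => ?_
  rw [key _ hp i (Finset.mem_range.mp hi), map_zero]

/-- The lowering operator f recovers all vectors from the top one, with nonzero factors in
characteristic zero. -/
theorem IsQuartic.quarticVec_eq_zero [CharZero K] {β : sl2 K →ₗ[K] sl2 K →ₗ[K] M}
    (hβ : IsQuartic β) (h : quarticVec β 4 = 0) {i : ℕ} (hi : i ≤ 4) : quarticVec β i = 0 := by
  induction hi using Nat.decreasingInduction with
  | self => exact h
  | of_succ k hk ih =>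
    have hF : ⁅sl2F K, quarticVec β (k + 1)⁆ = ((k + 1 : ℕ) : K) • quarticVec β k := by
      rw [hβ.lie_quarticVec _ (Nat.succ_le_of_lt hk)]
      simp [sl2F]
    rw [ih, lie_zero] at hF
    exact (smul_eq_zero.mp hF.symm).resolve_left (Nat.cast_ne_zero.mpr k.succ_ne_zero)

theorem range_le_lieIsotypicComponent {L V : Type*} [LieRing L] [LieAlgebra K L]
    [AddCommGroup V] [Module K V] [LieRingModule L V] {N : Type*} [AddCommGroup N] [Module K N]
    [LieRingModule L N] (g : V →ₗ⁅K, L⁆ N) (hg : Function.Injective g) :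
    g.range ≤ lieIsotypicComponent K L V N := by
  let e := LinearEquiv.ofInjective (g : V →ₗ[K] N) hg
  let e' : V ≃ₗ⁅K, L⁆ g.range :=
    { toFun := fun v => ⟨g v, v, rfl⟩
      map_add' := fun v w => Subtype.ext (map_add g v w)
      map_smul' := fun c v => Subtype.ext (map_smul g c v)
      map_lie' := fun {x v} => Subtype.ext (g.map_lie x v)
      invFun := e.symm
      left_inv := e.left_inv
      right_inv := e.right_inv }
  exact le_sSup ⟨e'.symm⟩

/-- By the two preceding criteria the homomorphism is zero or injective according to its top vector.
This dichotomy replaces an appeal to the simplicity of the quartic forms. -/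
theorem IsQuartic.range_le [CharZero K] {β : sl2 K →ₗ[K] sl2 K →ₗ[K] M}
    (hβ : IsQuartic β) : hβ.hom.range ≤ lieIsotypicComponent K (sl2 K) (BinaryForm K 4) M := by
  by_cases h : quarticVec β 4 = 0
  · rintro _ ⟨p, rfl⟩
    rw [hβ.hom_apply, Finset.sum_eq_zero fun i hi => ?_]
    · exact zero_mem _
    · rw [hβ.quarticVec_eq_zero h (Nat.lt_succ_iff.mp (Finset.mem_range.mp hi)), smul_zero]
  · exact range_le_lieIsotypicComponent _ (hβ.hom_injective h)

theorem IsQuartic.mem_isotypic [CharZero K] {β : sl2 K →ₗ[K] sl2 K →ₗ[K] M}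
    (hβ : IsQuartic β) (x y : sl2 K) :
    β x y ∈ lieIsotypicComponent K (sl2 K) (BinaryForm K 4) M :=
  hβ.mem_of_quarticVec_mem (lieIsotypicComponent K (sl2 K) (BinaryForm K 4) M).toSubmodule
    (fun _ hi => hβ.range_le (hβ.quarticVec_mem_range hi)) x y

end Quartic
end

noncomputable section

/-! ### The component of type `L(4)` of the exterior square of `TAG(J)` -/

section QuarticWedge

variable (K : Type u) [Field K] [CharZero K] {J : Type v} [NonUnitalNonAssocCommRing J] [Module K J]
  [SMulCommClass K J J] [IsScalarTower K J J] [IsCommJordan J]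

/-- The map `(x, y) ↦ x(a) ∧ y(b) + y(a) ∧ x(b) - ⅔ κ(x, y) ∑ xᵢ(a) ∧ xⁱ(b)`. -/
def quarticWedge (a b : J) : sl2 K →ₗ[K] sl2 K →ₗ[K] Ext₂ K (TAG K J) :=
  wedge.compl₁₂ ((TAG.tm K J).flip a) ((TAG.tm K J).flip b)
    + (wedge.compl₁₂ ((TAG.tm K J).flip a) ((TAG.tm K J).flip b)).flip
    -- The symmetrised tensor contracts to twice the Casimir sum and κ contracts to 3, so 2/3 is the
    -- coefficient that makes the result trace-free.
    - (kappa K).compr₂ (LinearMap.toSpanSingleton K _ ((2 / 3 : K) • casWedge K J a b))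

variable {K}

theorem quarticWedge_apply (a b : J) (x y : sl2 K) : quarticWedge K a b x y =
    wedge (K := K) (TAG.tm K J x a) (TAG.tm K J y b)
      + wedge (K := K) (TAG.tm K J y a) (TAG.tm K J x b)
      - kappa K x y • (2 / 3 : K) • casWedge K J a b := rfl

/-- The terms [x, y](ab) and [y, x](ab) cancel. The ℬJ terms 2κ(x, y){a ∧ b} cancel against ⅔ · 3
κ(x, y){a ∧ b}. -/
theorem ceD₂_quarticWedge (a b : J) (x y : sl2 K) :
    ceD₂ K (TAG K J) (quarticWedge K a b x y) = 0 := by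
  rw [quarticWedge_apply, map_sub, map_add, map_smul, map_smul, ceD₂_casWedge, ceD₂_wedge,
    ceD₂_wedge, TAG.lie_tm_tm, TAG.lie_tm_tm, kappa_swap x y, ← lie_skew x y, map_neg,
    LinearMap.neg_apply]
  module

theorem wedgeDer_tm (s x y : sl2 K) (a b : J) :
    wedgeDer (TAG.sl2Map K J s) (wedge (K := K) (TAG.tm K J x a) (TAG.tm K J y b)) =
      wedge (K := K) (TAG.tm K J ⁅s, x⁆ a) (TAG.tm K J y b)
      + wedge (K := K) (TAG.tm K J x a) (TAG.tm K J ⁅s, y⁆ b) :=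
  wedgeDer_wedge _ _ _

theorem wedgeDer_casWedge (s : sl2 K) (a b : J) :
    wedgeDer (TAG.sl2Map K J s) (casWedge K J a b) = 0 := by
  simp only [casWedge_apply, map_add, map_smul, wedgeDer_tm, sl2_lie_E, sl2_lie_H, sl2_lie_F,
    map_sub, LinearMap.sub_apply, LinearMap.smul_apply]
  module

theorem wedgeDer_quarticWedge (s x y : sl2 K) (a b : J) :
    wedgeDer (TAG.sl2Map K J s) (quarticWedge K a b x y) =
      quarticWedge K a b ⁅s, x⁆ y + quarticWedge K a b x ⁅s, y⁆ := by
  have hk : kappa K ⁅s, x⁆ y = -kappa K x ⁅s, y⁆ := by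
    rw [← lie_skew, map_neg, LinearMap.neg_apply, kappa_lie]
  simp only [quarticWedge_apply, map_add, map_sub, map_smul, wedgeDer_tm, wedgeDer_casWedge, hk]
  module

variable (K) in
/-- The bilinear map `quarticWedge` with values in the second homology. -/
def quarticClass (a b : J) : sl2 K →ₗ[K] sl2 K →ₗ[K] H₂ K (TAG K J) :=
  LinearMap.mk₂ K (fun x y => H₂.mk K _ ⟨quarticWedge K a b x y, ceD₂_quarticWedge a b x y⟩)
    (fun x x' y => by
      rw [← map_add]
      exact congrArg _ (Subtype.ext (LinearMap.map_add₂ (quarticWedge K a b) x x' y)))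
    (fun c x y => by
      rw [← map_smul]
      exact congrArg _ (Subtype.ext (LinearMap.map_smul₂ (quarticWedge K a b) c x y)))
    (fun x y y' => by
      rw [← map_add]
      exact congrArg _ (Subtype.ext (map_add (quarticWedge K a b x) y y')))
    (fun c x y => by
      rw [← map_smul]
      exact congrArg _ (Subtype.ext (map_smul (quarticWedge K a b x) c y)))

theorem quarticClass_apply (a b : J) (x y : sl2 K) : quarticClass K a b x y =
    H₂.mk K _ ⟨quarticWedge K a b x y, ceD₂_quarticWedge a b x y⟩ := rfl

theorem isQuartic_quarticClass (a b : J) : IsQuartic (quarticClass K a b) where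
  swap x y := by
    refine congrArg (H₂.mk K _) (Subtype.ext ?_)
    change quarticWedge K a b x y = quarticWedge K a b y x
    rw [quarticWedge_apply, quarticWedge_apply, kappa_swap x y]
    abel
  lie s x y := by
    change H₂.mk K _ (cycleDer (TAG.sl2Der s) _) = _
    rw [quarticClass_apply, quarticClass_apply, ← map_add]
    exact congrArg (H₂.mk K _) (Subtype.ext (wedgeDer_quarticWedge s x y a b))
  casimir := by
    rw [quarticClass_apply, quarticClass_apply, ← map_smul]
    refine congrArg (H₂.mk K _) (Subtype.ext ?_)
    change quarticWedge K a b (sl2H K) (sl2H K) = (-4 : K) • quarticWedge K a b (sl2E K) (sl2F K)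
    rw [quarticWedge_apply, quarticWedge_apply, kappa_HH, kappa_EF, casWedge_apply]
    module

variable (K J) in
/-- The span of the values of the maps `quarticWedge`. -/
def quarticSpan : Submodule K (Ext₂ K (TAG K J)) :=
  Submodule.span K (Set.range fun p : (J × J) × (sl2 K × sl2 K) =>
    quarticWedge K p.1.1 p.1.2 p.2.1 p.2.2)

/-- Passes from a span inside Λ² to a subspace of homology; the cycle condition is carried along the
induction, since a class exists only for a cycle. -/
theorem exists_mk_mem {S : Submodule K (H₂ K (TAG K J))}
    (hS : ∀ (a b : J) (x y : sl2 K), quarticClass K a b x y ∈ S) {φ : Ext₂ K (TAG K J)}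
    (hφ : φ ∈ quarticSpan K J) :
    ∃ h : φ ∈ cycles₂ K (TAG K J), H₂.mk K _ ⟨φ, h⟩ ∈ S := by
  induction hφ using Submodule.span_induction with
  | mem _ h =>
    obtain ⟨p, rfl⟩ := h
    exact ⟨ceD₂_quarticWedge _ _ _ _, hS _ _ _ _⟩
  | zero => exact ⟨zero_mem _, zero_mem S⟩
  | add φ φ' _ _ h h' =>
    obtain ⟨h, m⟩ := h
    obtain ⟨h', m'⟩ := h'
    exact ⟨add_mem h h', add_mem m m'⟩
  | smul c φ _ h =>
    obtain ⟨h, m⟩ := h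
    exact ⟨Submodule.smul_mem _ c h, S.smul_mem c m⟩

/-- A map `G : 𝔰𝔩₂ ⊗ J → Λ²` through which `adWedge` factors lets one decompose the exterior square
of `TAG(J)` into its isotypic components. -/
theorem exists_decomposition (G : J →ₗ[K] sl2 K →ₗ[K] LieExtSq K (TAG K J))
    (hG : ∀ a b, adWedge K J a b = G (a * b)) (z : Ext₂ K (TAG K J)) :
    ∃ (w : BJ K J) (u : sl2 K ⊗[K] J), ∃ φ ∈ quarticSpan K J,
      (LinearMap.range (ceD₃ K (TAG K J))).mkQ z = casB K J w + TensorProduct.lift G.flip u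
        + (LinearMap.range (ceD₃ K (TAG K J))).mkQ φ ∧
      LieExtSq.toLie K _ (TensorProduct.lift G.flip u) = (2 : K) • TAG.ofT K J u := by
  let g := TensorProduct.lift G.flip
  let A := LinearMap.range (casB K J)
  -- The values of G are known only on products ab, so its bracket need not be 2x(c) for a general
  -- c. The equaliser keeps just the tensors for which that formula holds, which suffices for `hB`.
  let B := (LinearMap.eqLocus (LieExtSq.toLie K _ ∘ₗ g) ((2 : K) • TAG.ofT K J)).map g
  let C := (quarticSpan K J).map (LinearMap.range (ceD₃ K (TAG K J))).mkQ
  let P := A ⊔ B ⊔ C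
  have hA : ∀ w, casB K J w ∈ P := fun w =>
    Submodule.mem_sup_left (Submodule.mem_sup_left ⟨w, rfl⟩)
  have hB : ∀ a b x, adWedge K J a b x ∈ P := fun a b x => by
    refine Submodule.mem_sup_left (Submodule.mem_sup_right ⟨x ⊗ₜ (a * b), ?_, ?_⟩)
    · change LieExtSq.toLie K _ (g (x ⊗ₜ (a * b))) = (2 : K) • TAG.tm K J x (a * b)
      rw [← toLie_adWedge, hG, TensorProduct.lift.tmul, LinearMap.flip_apply]
    · rw [hG, TensorProduct.lift.tmul, LinearMap.flip_apply]
  have hC : ∀ a b x y, (LinearMap.range (ceD₃ K (TAG K J))).mkQ (quarticWedge K a b x y) ∈ P :=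
    fun a b x y => Submodule.mem_sup_right
      (Submodule.mem_map_of_mem (Submodule.subset_span ⟨((a, b), (x, y)), rfl⟩))
  have hBB : ∀ w w', lieWedge K _ (TAG.ofB K J w) (TAG.ofB K J w') ∈ P := fun w w' => by
    rw [← P.smul_mem_iff (three_ne_zero : (3 : K) ≠ 0), lieWedge_ofB_ofB]
    exact neg_mem (hA _)
  have hBT : ∀ w x c, lieWedge K _ (TAG.ofB K J w) (TAG.tm K J x c) ∈ P := fun w x c => by
    induction w using BJ_induction with
    | hc a b =>
      rw [← P.smul_mem_iff (two_ne_zero : (2 : K) ≠ 0), lieWedge_ofB_tm]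
      exact sub_mem (hB _ _ _) (hB _ _ _)
    | ha w w' h h' => simp only [map_add, LinearMap.add_apply]; exact add_mem h h'
    | hs c w h => simp only [map_smul, LinearMap.smul_apply]; exact P.smul_mem _ h
  have hTT : ∀ x y a b, lieWedge K _ (TAG.tm K J x a) (TAG.tm K J y b) ∈ P := fun x y a b => by
    -- The splitting of 𝔰𝔩₂ ⊗ 𝔰𝔩₂ into its trace-free symmetric part, its trace and its
    -- antisymmetric part.
    have h : (2 : K) • lieWedge K _ (TAG.tm K J x a) (TAG.tm K J y b) =
        (LinearMap.range (ceD₃ K (TAG K J))).mkQ (quarticWedge K a b x y)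
        + kappa K x y • (2 / 3 : K) • casB K J (curly K a b) + adWedge K J a b ⁅x, y⁆ := by
      rw [quarticWedge_apply, adWedge_lie, map_sub, map_add, mkQ_wedge, mkQ_wedge, map_smul,
        map_smul, casB_curly]
      module
    rw [← P.smul_mem_iff (two_ne_zero : (2 : K) ≠ 0), h]
    exact add_mem (add_mem (hC _ _ _ _) (P.smul_mem _ (P.smul_mem _ (hA _)))) (hB _ _ _)
  have hP : (LinearMap.range (ceD₃ K (TAG K J))).mkQ z ∈ P := by
    induction z using wedge_induction with
    | ha z z' h h' => rw [map_add]; exact add_mem h h'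
    | hs c z h => rw [map_smul]; exact P.smul_mem _ h
    | hw X Y =>
      rw [mkQ_wedge]
      induction X using TAG.induction with
      | ha X X' h h' => rw [map_add, LinearMap.add_apply]; exact add_mem h h'
      | hB w =>
        induction Y using TAG.induction with
        | ha Y Y' h h' => rw [map_add]; exact add_mem h h'
        | hB w' => exact hBB w w'
        | hT y b => exact hBT w y b
      | hT x a =>
        induction Y using TAG.induction with
        | ha Y Y' h h' => rw [map_add]; exact add_mem h h'
        | hB w' => rw [lieWedge_swap]; exact neg_mem (hBT w' x a)
        | hT y b => exact hTT x y a b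
  obtain ⟨p, hp, q, ⟨φ, hφ, rfl⟩, h⟩ := Submodule.mem_sup.mp hP
  obtain ⟨r, ⟨w, rfl⟩, t, ⟨u, hu, rfl⟩, rfl⟩ := Submodule.mem_sup.mp hp
  exact ⟨w, u, φ, hφ, h.symm, hu⟩

end QuarticWedge

/-! ### The second homology for a free Jordan algebra. -/

section FreeHomology

variable {K : Type u} [Field K] [CharZero K] {X : Type v}

/-- The second homology of `TAG(J)`, for a free Jordan algebra `J`, is spanned by the classes
`quarticClass`. -/
theorem mem_of_quarticClass_mem {S : Submodule K (H₂ K (TAG K (FreeJordan K X)))}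
    (hS : ∀ a b x y, quarticClass K a b x y ∈ S) (c : H₂ K (TAG K (FreeJordan K X))) : c ∈ S := by
  obtain ⟨G, hG⟩ := FreeJordan.exists_linearMap_mul (adWedge K (FreeJordan K X)) adWedge_swap
    adWedge_jordan
  obtain ⟨⟨z, hz⟩, rfl⟩ := H₂.mk_surjective c
  obtain ⟨w, u, φ, hφ, h, hu⟩ := exists_decomposition G hG z
  obtain ⟨hφ', hm⟩ := exists_mk_mem hS hφ
  -- Both z and φ are cycles, so the bracket map gives 0 = 3w + 2u in ℬJ ⊕ 𝔰𝔩₂ ⊗ J. The two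
  -- components vanish separately, and z is homologous to φ.
  have h0 := congrArg (LieExtSq.toLie K _) h
  rw [map_add, map_add, LieExtSq.toLie_mkQ, LieExtSq.toLie_mkQ, LinearMap.mem_ker.mp hz,
    LinearMap.mem_ker.mp hφ', add_zero, hu, toLie_casB] at h0
  have hw : w = 0 := by
    have h1 := congrArg (TAG.fstB K _) h0
    simp only [map_add, map_smul, TAG.fstB_ofB, TAG.fstB_ofT, smul_zero, add_zero, map_zero] at h1
    exact (smul_eq_zero.mp h1.symm).resolve_left three_ne_zero
  have hu' : u = 0 := by
    have h1 := congrArg (TAG.sndT K _) h0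
    simp only [map_add, map_smul, TAG.sndT_ofB, TAG.sndT_ofT, smul_zero, zero_add, map_zero] at h1
    exact (smul_eq_zero.mp h1.symm).resolve_left two_ne_zero
  rw [hw, hu', map_zero, map_zero, zero_add, zero_add] at h
  have hzφ : H₂.mk K _ ⟨z, hz⟩ = H₂.mk K _ ⟨φ, hφ'⟩ :=
    (Submodule.Quotient.eq _).mpr ((Submodule.Quotient.eq (LinearMap.range (ceD₃ K _))).mp h)
  rw [hzφ]
  exact hm

/-- The Casimir element acts by `24` on the second homology. -/
theorem casimir_act_H₂ (c : H₂ K (TAG K (FreeJordan K X))) :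
    ⁅sl2H K, ⁅sl2H K, c⁆⁆ + (2 : K) • ⁅sl2E K, ⁅sl2F K, c⁆⁆
      + (2 : K) • ⁅sl2F K, ⁅sl2E K, c⁆⁆ = (24 : K) • c := by
  let φ : sl2 K → Module.End K (H₂ K (TAG K (FreeJordan K X))) :=
    LieModule.toEnd K (sl2 K) (H₂ K (TAG K (FreeJordan K X)))
  exact mem_of_quarticClass_mem
    (S := LinearMap.eqLocus (φ (sl2H K) * φ (sl2H K) + (2 : K) • (φ (sl2E K) * φ (sl2F K))
      + (2 : K) • (φ (sl2F K) * φ (sl2E K))) ((24 : K) • 1))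
    (fun a b x y => (isQuartic_quarticClass a b).casimir_act x y) c

end FreeHomology

end

/-! ### The isotypic components, separated by the Casimir element. -/

theorem mainTheorem4 (K : Type*) [Field K] [CharZero K] (D : ℕ) (hD : 1 ≤ D) :
    LieModule.maxTrivSubmodule K (sl2 K) (H₂ K (TAG K (FreeJordan K (Fin D)))) = ⊥ ∧
    lieIsotypicComponent K (sl2 K) (sl2 K) (H₂ K (TAG K (FreeJordan K (Fin D)))) = ⊥ ∧
    lieIsotypicComponent K (sl2 K) (BinaryForm K 4) (H₂ K (TAG K (FreeJordan K (Fin D)))) = ⊤ := by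
  refine ⟨?_, ?_, ?_⟩
  · refine (LieSubmodule.eq_bot_iff _).mpr fun c hc => ?_
    rw [LieModule.mem_maxTrivSubmodule] at hc
    -- On an invariant vector the Casimir element gives 0, but it must also give 24c.
    have h := casimir_act_H₂ c
    simp only [hc, lie_zero, smul_zero, add_zero] at h
    exact (smul_eq_zero.mp h.symm).resolve_left (by norm_num)
  · refine sSup_eq_bot.mpr ?_
    rintro N ⟨e⟩
    refine (LieSubmodule.eq_bot_iff _).mpr fun c hc => ?_
    have h24 : ⁅sl2H K, ⁅sl2H K, (⟨c, hc⟩ : N)⁆⁆ + (2 : K) • ⁅sl2E K, ⁅sl2F K, (⟨c, hc⟩ : N)⁆⁆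
        + (2 : K) • ⁅sl2F K, ⁅sl2E K, (⟨c, hc⟩ : N)⁆⁆ = (24 : K) • (⟨c, hc⟩ : N) :=
      Subtype.ext (casimir_act_H₂ c)
    have he : ∀ s n, e ⁅s, n⁆ = ⁅s, e n⁆ := fun s n => e.toLieModuleHom.map_lie s n
    have hadd : ∀ m n, e (m + n) = e m + e n := fun m n => e.toLieModuleHom.map_add m n
    have hsmul : ∀ (r : K) n, e (r • n) = r • e n := fun r n => e.toLieModuleHom.map_smul r n
    have h := congrArg e h24
    simp only [hadd, hsmul, he, sl2_double_lie', kappa_HH, kappa_EF, kappa_FE] at h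
    -- On the adjoint module the Casimir element acts by 12 - 4 = 8, where 4 comes from the
    -- dual-basis expansion; 16 is 24 - 8.
    have h16 : (16 : K) • e ⟨c, hc⟩ = 0 := by
      linear_combination (norm := module) -h - (4 : K) • sl2_kappa_expand (e ⟨c, hc⟩)
    have h0 : e ⟨c, hc⟩ = e 0 :=
      ((smul_eq_zero.mp h16).resolve_left (by norm_num)).trans e.toLieModuleHom.map_zero.symm
    exact congrArg Subtype.val (e.injective h0)
  · refine eq_top_iff.mpr fun c _ => ?_
    exact mem_of_quarticClass_mem
      (S := (lieIsotypicComponent K (sl2 K) (BinaryForm K 4) _).toSubmodule)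
      (fun a b x y => (isQuartic_quarticClass a b).mem_isotypic x y) c
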